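/- All states are pure three-qutrit states, i.e. nonzero vectors of $(\mathbb{C}^3)^{\otimes 3}$ considered up to a nonzero factor, and $$|A_3\rangle=\frac{1}{\sqrt6}\sum_{\pi\in S_3}\mathrm{sgn}(\pi)\,|\pi(1),\pi(2),\pi(3)\rangle .$$ The SLOCC class of a state $|\psi\rangle$ is $\{g_1\otimes g_2\otimes g_3|\psi\rangle : g_i\in GL(3,\mathbb{C})\}$; two states are LU-equivalent if they are related by $U_1\otimes U_2\otimes U_3$ with unitary $U_i$ (up to a factor). One round of LOCC consists of a local measurement by one party with finitely many Kraus operators $K_k\in\mathbb{C}^{3\times3}$, $\sum_k K_k^\dagger K_k=\mathbb{1}$, after which every other party applies a unitary depending on the outcome $k$; later rounds may depend on all earlier outcomes. $|\psi\rangle$ is transformed into $|\phi\rangle$ by LOCC in at most $r$ rounds if some such protocol yields $|\phi\rangle$ (up to a factor) for all sequences of outcomes of nonzero probability. $\mathrm{LOCC}_{\mathbb N}$ consists of the transformations with some finite number of rounds, while LOCC also admits protocols with infinitely many rounds whose $r$-round outputs converge to $|\phi\rangle$ as $r\to\infty$. A state is LOCC-reachable ($\mathrm{LOCC}_{\mathbb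 N}$-reachable) if it can be obtained by LOCC ($\mathrm{LOCC}_{\mathbb N}$) from some state in its SLOCC class that is not LU-equivalent to it. The maximally entangled set (MES) of an SLOCC class is the set of states in the class that are not LOCC-reachable. Consider the following states. 1. Type (i): $|A_3\rangle$. 2. Type (ii): $|\psi_2(\alpha_1;\alpha_2)\rangle\propto \mathrm{diag}(\sqrt{\alpha_1},1,1)\otimes\mathrm{diag}(\sqrt{\alpha_2},1,1)\otimes\mathbb{1}\,|A_3\rangle$, where $\alpha_1,\alpha_2>0$, $\alpha_1\neq\alpha_2$ and $\alpha_1,\alpha_2\neq1$. 3. Type (iii): $|\psi_3(\alpha_1,\beta_1;\alpha_2,\beta_2)\rangle\propto \mathrm{diag}(\sqrt{\alpha_1},\sqrt{\beta_1},1)\otimes\mathrm{diag}(\sqrt{\alpha_2},\sqrt{\beta_2},1)\otimes\mathbb{1}\,|A_3\rangle$, where $\alpha_1,\alpha_2,\beta_1,\beta_2>0$, $\alpha_1\neq\beta_1$, $\beta_1\neq\beta_2$, $\beta_2\neq\alpha_2$, $\alpha_1\neq\alpha_2$, $\frac{\alpha_1}{\beta_1}\neq\frac{\alpha_2}{\beta_2}$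 and $\alpha_1,\alpha_2,\beta_1,\beta_2\neq1$. Let $M_{A_3}$ be the set of all states that are LU-equivalent to a state of type (i), (ii) or (iii). Then: (a) Every state in the SLOCC class of $|A_3\rangle$ is LU-equivalent to a state of type (i), (ii) or (iii), or can be obtained from such a state by LOCC in at most 3 rounds. (b) $M_{A_3}$ is contained in the SLOCC class of $|A_3\rangle$, and no state in $M_{A_3}$ is $\mathrm{LOCC}_{\mathbb N}$-reachable. (c) The MES of the SLOCC class of $|A_3\rangle$ is contained in $M_{A_3}$. (d) $M_{A_3}$ has measure zero in the SLOCC class of $|A_3\rangle$: the set of all $(g_1,g_2,g_3)\in GL(3,\mathbb{C})^3$ with $g_1\otimes g_2\otimes g_3|A_3\rangle\in M_{A_3}$ is a Lebesgue null set in $(\mathbb{C}^{3\times3})^3$. -/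

import Mathlib

open scoped Matrix

noncomputable section

namespace QuditLOCC

/-- Pure states of `n` qudits of local dimension `d`, unnormalized: vectors of `(ℂ^d)^{⊗n}` in
coordinates with respect to the product basis `|x 0, …, x (n-1)⟩`, with the Hilbert space norm.
Physical states are nonzero vectors up to a nonzero factor. -/
abbrev QState (n d : ℕ) := EuclideanSpace ℂ (Fin n → Fin d)

/-- The operator `A 0 ⊗ A 1 ⊗ ⋯ ⊗ A (n-1)` in the product basis. -/
def localOp {n d : ℕ} (A : Fin n → Matrix (Fin d) (Fin d) ℂ) :
    Matrix (Fin n → Fin d) (Fin n → Fin d) ℂ :=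
  Matrix.of fun x y => ∏ i, A i (x i) (y i)

/-- The vector `(A 0 ⊗ A 1 ⊗ ⋯ ⊗ A (n-1)) |ψ⟩`. -/
def applyLocal {n d : ℕ} (A : Fin n → Matrix (Fin d) (Fin d) ℂ) (ψ : QState n d) : QState n d :=
  WithLp.toLp 2 (localOp A *ᵥ ψ.ofLp)

/-- Equality of states up to normalization and global phase, `ψ ∝ φ`. -/
def Proportional {n d : ℕ} (ψ φ : QState n d) : Prop :=
  ∃ c : ℂ, c ≠ 0 ∧ ψ = c • φ

/-- Equivalence under local unitaries (as unnormalized states, i.e. up to a nonzero factor). -/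
def LUEquiv {n d : ℕ} (ψ φ : QState n d) : Prop :=
  ∃ U : Fin n → Matrix.unitaryGroup (Fin d) ℂ,
    Proportional φ (applyLocal (fun i => (U i : Matrix (Fin d) (Fin d) ℂ)) ψ)

/-- The SLOCC class of `ψ`: its orbit under local invertible operators. -/
def SLOCCClass {n d : ℕ} (ψ : QState n d) : Set (QState n d) :=
  {φ | ∃ g : Fin n → GL (Fin d) ℂ, φ = applyLocal (fun i => (g i : Matrix (Fin d) (Fin d) ℂ)) ψ}

/-- One round of LOCC: one party performs a local measurement with finitely many Kraus operators,
and, depending on the (broadcast) outcome, every other party applies a unitary. The entry of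
`unitaries k` at the measuring party is not used. -/
structure Round (n d : ℕ) where
  party : Fin n
  outcomes : ℕ
  kraus : Fin outcomes → Matrix (Fin d) (Fin d) ℂ
  complete : ∑ k, (kraus k)ᴴ * kraus k = 1
  unitaries : Fin outcomes → Fin n → Matrix.unitaryGroup (Fin d) ℂ

/-- The unnormalized state after outcome `k` of a round; its squared norm divided by that of `ψ`
is the probability of the outcome. -/
def Round.branch {n d : ℕ} (R : Round n d) (k : Fin R.outcomes) (ψ : QState n d) : QState n d :=
  applyLocal (Function.update
    (fun j => (R.unitaries k j : Matrix (Fin d) (Fin d) ℂ)) R.party (R.kraus k)) ψ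

/-- An LOCC protocol: to each list of outcomes obtained so far (the earliest outcome first) it
assigns the round to be performed next. A finite-round protocol is one that is stopped after a
fixed number of rounds. -/
abbrev Protocol (n d : ℕ) := List ℕ → Round n d

/-- The protocol that remains after the first round had outcome `k`. -/
def Protocol.after {n d : ℕ} (P : Protocol n d) (k : ℕ) : Protocol n d :=
  fun h => P (k :: h)

/-- If the protocol `P` is run for `r` rounds on the initial state `ψ`, then the final state is `φ`
(up to normalization and phase) for every sequence of outcomes of nonzero probability. -/
def Protocol.Transforms {n d : ℕ} : ℕ → Protocol n d → QState n d → QState n d → Prop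
  | 0, _, ψ, φ => Proportional ψ φ
  | r + 1, P, ψ, φ => ∀ k : Fin (P []).outcomes, (P []).branch k ψ ≠ 0 →
      Protocol.Transforms r (P.after k) ((P []).branch k ψ) φ

/-- `∑ |⟨φ|ψ_h⟩|²` over the unnormalized states `ψ_h` of all branches after `r` rounds of `P`
on `ψ`. For unit vectors it is the fidelity `⟨φ|ρ_r|φ⟩` of `φ` with the output
`ρ_r = ∑ |ψ_h⟩⟨ψ_h|` of the `r`-round protocol. -/
def Protocol.fidelity {n d : ℕ} : ℕ → Protocol n d → QState n d → QState n d → ℝ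
  | 0, _, ψ, φ => ‖inner ℂ φ ψ‖ ^ 2
  | r + 1, P, ψ, φ => ∑ k : Fin (P []).outcomes,
      Protocol.fidelity r (P.after k) ((P []).branch k ψ) φ

/-- `ψ` can be transformed into `φ` deterministically by LOCC in at most `r` rounds. (Unused
rounds can be filled with the trivial measurement.) -/
def LOCCInRounds {n d : ℕ} (r : ℕ) (ψ φ : QState n d) : Prop :=
  ∃ P : Protocol n d, P.Transforms r ψ φ

/-- Convertibility with finite-round LOCC. -/
def LOCCNConvertible {n d : ℕ} (ψ φ : QState n d) : Prop :=
  ∃ r : ℕ, LOCCInRounds r ψ φ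

/-- Convertibility with general LOCC, including protocols with infinitely many rounds: the output
of the first `r` rounds converges to `φ` as `r → ∞`. -/
def LOCCConvertible {n d : ℕ} (ψ φ : QState n d) : Prop :=
  ∃ P : Protocol n d,
    Filter.Tendsto (fun r => P.fidelity r ψ φ) Filter.atTop (nhds (‖ψ‖ ^ 2 * ‖φ‖ ^ 2))

/-- `φ` is reachable by finite-round LOCC from an SLOCC-equivalent, LU-inequivalent state. -/
def LOCCNReachable {n d : ℕ} (φ : QState n d) : Prop :=
  ∃ ψ ∈ SLOCCClass φ, ¬ LUEquiv ψ φ ∧ LOCCNConvertible ψ φ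

/-- `φ` is reachable by general LOCC from an SLOCC-equivalent, LU-inequivalent state. -/
def LOCCReachable {n d : ℕ} (φ : QState n d) : Prop :=
  ∃ ψ ∈ SLOCCClass φ, ¬ LUEquiv ψ φ ∧ LOCCConvertible ψ φ

/-- The maximally entangled set of the SLOCC class of `seed`: the states of the class that are not
reachable by LOCC. (It is a union of LU orbits.) -/
def maximallyEntangledSet {n d : ℕ} (seed : QState n d) : Set (QState n d) :=
  {φ ∈ SLOCCClass seed | ¬ LOCCReachable φ}

/-- `S` has measure zero in the SLOCC class of `seed`, the class being the image of
`GL(d,ℂ)^n ⊆ (ℂ^{d×d})^n` under the orbit map: the set of all `(g 0, …, g (n-1))` in `GL(d,ℂ)^n`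
with `(g 0 ⊗ ⋯ ⊗ g (n-1)) |seed⟩ ∈ S` is a Lebesgue null set. -/
def NullInSLOCCClass {n d : ℕ} (seed : QState n d) (S : Set (QState n d)) : Prop :=
  MeasureTheory.volume {g : Fin n → Fin d → Fin d → ℂ |
    (∀ i, IsUnit (Matrix.of (g i)).det) ∧ applyLocal (fun i => Matrix.of (g i)) seed ∈ S} = 0

/-- The totally antisymmetric state `(n!)^{-1/2} ∑_π sgn(π) |π(0), …, π(n-1)⟩`. -/
def antisymmState (n : ℕ) : QState n n :=
  (((Real.sqrt (n.factorial : ℝ))⁻¹ : ℝ) : ℂ) •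
    ∑ π : Equiv.Perm (Fin n),
      ((Equiv.Perm.sign π : ℤ) : ℂ) • EuclideanSpace.single (fun i => π i) (1 : ℂ)

/-- The three-qutrit totally antisymmetric state `|A₃⟩`. -/
def A3 : QState 3 3 := antisymmState 3

/-- The vector `diag(√α₁,√β₁,1) ⊗ diag(√α₂,√β₂,1) ⊗ 𝟙 |A₃⟩`. -/
def diagState (α₁ β₁ α₂ β₂ : ℝ) : QState 3 3 :=
  applyLocal ![Matrix.diagonal ![((Real.sqrt α₁ : ℝ) : ℂ), ((Real.sqrt β₁ : ℝ) : ℂ), 1],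
    Matrix.diagonal ![((Real.sqrt α₂ : ℝ) : ℂ), ((Real.sqrt β₂ : ℝ) : ℂ), 1], 1] A3

/-- Type (i): `|A₃⟩`. -/
def IsTypeI (ψ : QState 3 3) : Prop := Proportional ψ A3

/-- Type (ii): `diag(√α₁,1,1) ⊗ diag(√α₂,1,1) ⊗ 𝟙 |A₃⟩`. -/
def IsTypeII (ψ : QState 3 3) : Prop :=
  ∃ α₁ α₂ : ℝ, 0 < α₁ ∧ 0 < α₂ ∧ α₁ ≠ α₂ ∧ α₁ ≠ 1 ∧ α₂ ≠ 1 ∧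
    Proportional ψ (diagState α₁ 1 α₂ 1)

/-- Type (iii): `diag(√α₁,√β₁,1) ⊗ diag(√α₂,√β₂,1) ⊗ 𝟙 |A₃⟩`. -/
def IsTypeIII (ψ : QState 3 3) : Prop :=
  ∃ α₁ β₁ α₂ β₂ : ℝ, 0 < α₁ ∧ 0 < β₁ ∧ 0 < α₂ ∧ 0 < β₂ ∧
    α₁ ≠ β₁ ∧ β₁ ≠ β₂ ∧ β₂ ≠ α₂ ∧ α₁ ≠ α₂ ∧ α₁ / β₁ ≠ α₂ / β₂ ∧
    α₁ ≠ 1 ∧ α₂ ≠ 1 ∧ β₁ ≠ 1 ∧ β₂ ≠ 1 ∧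
    Proportional ψ (diagState α₁ β₁ α₂ β₂)

/-- `M_{A₃}`: the states that are of type (i), (ii) or (iii) up to LU. -/
def MA3 : Set (QState 3 3) :=
  {φ | ∃ ψ, (IsTypeI ψ ∨ IsTypeII ψ ∨ IsTypeIII ψ) ∧ LUEquiv ψ φ}

end QuditLOCC

end

/-!
Since `A ⊗ B ⊗ C |A₃⟩` has as coordinates the determinants of one row each of `A`, `B` and `C`
(`applyLocal_antisymmState`), replacing `(A, B, C)` by `(A S, B S, C S)` only multiplies the state
by `det S`, and these are the only coincidences (`exists_of_proportional_A3`). Hence a state of the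
SLOCC class is determined up to local unitaries by the three Gram matrices `Aᴴ A`, `Bᴴ B`, `Cᴴ C`,
each up to a positive factor, modulo a common change of basis `G ↦ Sᴴ G S` (`GramEquiv`).

A round of measurement by one party can change only that party's Gram matrix. A state is reached in
one round from a state outside its LU orbit if some change of basis `S` fixes two of its Gram
matrices but not the third, the latter being replaced by an average over such `S`
(`loccInRounds_one_of_gram`). States without such an `S` are called rigid here. The states of the
three types are the ones with simultaneously diagonalizable Gram matrices whose diagonals satisfy
`IsBalanced`: two indices at which two parties have the same ratio are proportional for all parties.
Balanced states are rigid (`IsBalanced.gramProp`), and by induction on the number of rounds a rigid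
state can be obtained only from its own LU orbit (`gramEquiv_of_transforms`): all branches of a
round have the same Gram matrices up to interchangeable changes of basis, and completeness of the
measurement adds them up.

Conversely, any state is reached in one round from a diagonal one by averaging over sign flips
(`exists_diagOps_loccInRounds_one`), and an unbalanced diagonal state is reached from a balanced one
by averaging over the swap of two indices and, if necessary, over the cyclic permutations of all
three (`exists_balanced_loccInRounds`). This makes three rounds in total, so that unreachable states
lie in `M_{A₃}`; a finite protocol is an infinite one that idles from some round on.

Finally, simultaneously diagonalizable Gram matrices satisfy `G₁ G₀⁻¹ G₂ = G₂ G₀⁻¹ G₁`, a polynomial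
condition on real and imaginary parts that fails at some point `x₀`. On each line through `x₀` it has
finitely many solutions, so the solution set is null (`measure_zero_of_countable_lines`).
-/

noncomputable section
namespace QuditLOCC

/-! ### Local operators -/

theorem localOp_mul {n d : ℕ} (A B : Fin n → Matrix (Fin d) (Fin d) ℂ) :
    localOp A * localOp B = localOp (fun i => A i * B i) := by
  ext x z
  simp only [localOp, Matrix.mul_apply, Matrix.of_apply, ← Finset.prod_mul_distrib]
  rw [Finset.prod_univ_sum, Fintype.piFinset_univ]

theorem localOp_one {n d : ℕ} :
    localOp (fun _ => 1 : Fin n → Matrix (Fin d) (Fin d) ℂ) = 1 := by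
  ext x y
  simp only [localOp, Matrix.of_apply, Matrix.one_apply, Finset.prod_ite_zero, funext_iff]
  simp

theorem localOp_conjTranspose {n d : ℕ} (A : Fin n → Matrix (Fin d) (Fin d) ℂ) :
    (localOp A)ᴴ = localOp (fun i => (A i)ᴴ) := by
  ext x y
  simp [localOp, Matrix.conjTranspose_apply]

theorem localOp_update_sum {n d : ℕ} {ι : Type*} (s : Finset ι)
    (A : Fin n → Matrix (Fin d) (Fin d) ℂ) (p : Fin n) (B : ι → Matrix (Fin d) (Fin d) ℂ) :
    localOp (Function.update A p (∑ k ∈ s, B k)) = ∑ k ∈ s, localOp (Function.update A p (B k)) := by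
  ext x y
  have key : ∀ C : Matrix (Fin d) (Fin d) ℂ, localOp (Function.update A p C) x y =
      C (x p) (y p) * ∏ i ∈ Finset.univ.erase p, A i (x i) (y i) := by
    intro C
    simp only [localOp, Matrix.of_apply]
    rw [← Finset.mul_prod_erase _ _ (Finset.mem_univ p)]
    congr 1
    · simp
    · refine Finset.prod_congr rfl fun i hi => ?_
      rw [Function.update_of_ne (Finset.ne_of_mem_erase hi)]
  simp only [Matrix.sum_apply, key, Finset.sum_mul]

theorem applyLocal_applyLocal {n d : ℕ} (A B : Fin n → Matrix (Fin d) (Fin d) ℂ)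
    (ψ : QState n d) :
    applyLocal A (applyLocal B ψ) = applyLocal (fun i => A i * B i) ψ := by
  simp [applyLocal, localOp_mul]

theorem applyLocal_one {n d : ℕ} (ψ : QState n d) : applyLocal (fun _ => 1) ψ = ψ := by
  simp [applyLocal, localOp_one]

theorem applyLocal_smul {n d : ℕ} (A : Fin n → Matrix (Fin d) (Fin d) ℂ) (c : ℂ)
    (ψ : QState n d) : applyLocal A (c • ψ) = c • applyLocal A ψ := by
  simp [applyLocal, Matrix.mulVec_smul]

theorem applyLocal_zero {n d : ℕ} (A : Fin n → Matrix (Fin d) (Fin d) ℂ) :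
    applyLocal A (0 : QState n d) = 0 := by
  simp [applyLocal]

theorem applyLocal_smul_left {n d : ℕ} (c : Fin n → ℂ) (A : Fin n → Matrix (Fin d) (Fin d) ℂ)
    (ψ : QState n d) :
    applyLocal (fun i => c i • A i) ψ = (∏ i, c i) • applyLocal A ψ := by
  have : localOp (fun i => c i • A i) = (∏ i, c i) • localOp A := by
    ext x y
    simp [localOp, Finset.prod_mul_distrib]
  simp [applyLocal, this, Matrix.smul_mulVec]

/-- A scalar factor can be absorbed in the operator of any one party. -/
theorem smul_applyLocal {n d : ℕ} (p : Fin n) (c : ℂ) (A : Fin n → Matrix (Fin d) (Fin d) ℂ)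
    (ψ : QState n d) :
    c • applyLocal A ψ = applyLocal (fun i => (if i = p then c else 1) • A i) ψ := by
  rw [applyLocal_smul_left]
  simp

theorem norm_sq_applyLocal {n d : ℕ} (A : Fin n → Matrix (Fin d) (Fin d) ℂ) (ψ : QState n d) :
    ((‖applyLocal A ψ‖ ^ 2 : ℝ) : ℂ) =
      star ψ.ofLp ⬝ᵥ (localOp (fun i => (A i)ᴴ * A i) *ᵥ ψ.ofLp) := by
  have h := inner_self_eq_norm_sq_to_K (𝕜 := ℂ) (applyLocal A ψ)
  rw [EuclideanSpace.inner_eq_star_dotProduct] at h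
  rw [← localOp_mul, ← localOp_conjTranspose, ← Matrix.mulVec_mulVec, Matrix.dotProduct_mulVec,
    Matrix.vecMul_conjTranspose, star_star, dotProduct_comm]
  push_cast
  exact h.symm

/-- The probabilities of the outcomes of a round add up to one. -/
theorem Round.sum_norm_sq_branch {n d : ℕ} (R : Round n d) (ψ : QState n d) :
    ∑ k, ‖R.branch k ψ‖ ^ 2 = ‖ψ‖ ^ 2 := by
  have key : ∀ k, ((‖R.branch k ψ‖ ^ 2 : ℝ) : ℂ) = star ψ.ofLp ⬝ᵥ
      (localOp (Function.update (fun _ => 1) R.party ((R.kraus k)ᴴ * R.kraus k)) *ᵥ ψ.ofLp) := by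
    intro k
    rw [Round.branch, norm_sq_applyLocal]
    congr 3
    funext i
    by_cases h : i = R.party
    · subst h; simp
    · simp only [Function.update_of_ne h]
      exact Matrix.UnitaryGroup.star_mul_self (R.unitaries k i)
  have h1 : ((‖ψ‖ ^ 2 : ℝ) : ℂ) = star ψ.ofLp ⬝ᵥ (localOp (fun _ => 1) *ᵥ ψ.ofLp) := by
    have := norm_sq_applyLocal (fun _ => 1) ψ
    rw [applyLocal_one] at this
    simpa using this
  have h2 : localOp (fun _ => 1) = ∑ k, localOp (Function.update (fun _ : Fin n => 1) R.party
      ((R.kraus k)ᴴ * R.kraus k)) := by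
    rw [← localOp_update_sum, R.complete, Function.update_eq_self_iff.2 rfl]
  have h3 : ((∑ k, ‖R.branch k ψ‖ ^ 2 : ℝ) : ℂ) = ((‖ψ‖ ^ 2 : ℝ) : ℂ) := by
    rw [h1, h2, Matrix.sum_mulVec, dotProduct_sum]
    push_cast
    exact Finset.sum_congr rfl fun k _ => by simpa using key k
  exact_mod_cast h3

theorem Round.exists_branch_ne_zero {n d : ℕ} (R : Round n d) {ψ : QState n d} (hψ : ψ ≠ 0) :
    ∃ k, R.branch k ψ ≠ 0 := by
  by_contra! h
  have := R.sum_norm_sq_branch ψ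
  rw [Finset.sum_eq_zero fun k _ => by simp [h k]] at this
  exact hψ (norm_eq_zero.1 (pow_eq_zero_iff two_ne_zero |>.1 this.symm))

theorem Proportional.refl {n d : ℕ} (ψ : QState n d) : Proportional ψ ψ :=
  ⟨1, one_ne_zero, (one_smul ℂ ψ).symm⟩

theorem Proportional.symm {n d : ℕ} {ψ φ : QState n d} (h : Proportional ψ φ) :
    Proportional φ ψ := by
  obtain ⟨c, hc, rfl⟩ := h
  exact ⟨c⁻¹, inv_ne_zero hc, by rw [smul_smul, inv_mul_cancel₀ hc, one_smul]⟩

theorem Proportional.trans {n d : ℕ} {ψ φ χ : QState n d} (h : Proportional ψ φ)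
    (h' : Proportional φ χ) : Proportional ψ χ := by
  obtain ⟨c, hc, rfl⟩ := h
  obtain ⟨c', hc', rfl⟩ := h'
  exact ⟨c * c', mul_ne_zero hc hc', by rw [smul_smul]⟩

theorem Proportional.applyLocal {n d : ℕ} (A : Fin n → Matrix (Fin d) (Fin d) ℂ)
    {ψ φ : QState n d} (h : Proportional ψ φ) :
    Proportional (applyLocal A ψ) (QuditLOCC.applyLocal A φ) := by
  obtain ⟨c, hc, rfl⟩ := h
  exact ⟨c, hc, applyLocal_smul A c φ⟩

/-! ### The totally antisymmetric state and its stabilizer -/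

/-- The coordinates of `(A 0 ⊗ ⋯ ⊗ A (n-1)) |Aₙ⟩` are, up to normalization, determinants formed
from one row of each operator. -/
theorem applyLocal_antisymmState {n : ℕ} (A : Fin n → Matrix (Fin n) (Fin n) ℂ)
    (x : Fin n → Fin n) :
    (applyLocal A (antisymmState n)).ofLp x = (((Real.sqrt (n.factorial : ℝ))⁻¹ : ℝ) : ℂ) *
      (Matrix.of fun i j => A i (x i) j).det := by
  rw [antisymmState, applyLocal_smul, ← Matrix.det_transpose, Matrix.det_apply]
  simp only [PiLp.smul_apply, smul_eq_mul, applyLocal]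
  congr 1
  simp [Matrix.mulVec_sum, Matrix.mulVec_smul, localOp, zsmul_eq_mul, Units.smul_def]

theorem applyLocal_mul_right_antisymmState {n : ℕ} (A : Fin n → Matrix (Fin n) (Fin n) ℂ)
    (S : Matrix (Fin n) (Fin n) ℂ) :
    applyLocal (fun i => A i * S) (antisymmState n) =
      S.det • applyLocal A (antisymmState n) := by
  ext x
  rw [PiLp.smul_apply, applyLocal_antisymmState, applyLocal_antisymmState, smul_eq_mul,
    mul_left_comm, mul_comm S.det, ← Matrix.det_mul]
  congr 2

/-- An operator of one party that annihilates a state of the class is zero. -/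
theorem applyLocal_update_antisymmState_eq_zero {p : Fin 3} {V : Matrix (Fin 3) (Fin 3) ℂ}
    {G : Fin 3 → Matrix (Fin 3) (Fin 3) ℂ} (hG : ∀ j ≠ p, IsUnit (G j).det)
    (h : applyLocal (Function.update G p V) A3 = 0) : V = 0 := by
  have h1 : applyLocal (Function.update (fun _ => 1) p V) A3 = 0 := by
    have := congrArg (applyLocal (Function.update (fun j => (G j)⁻¹) p 1)) h
    rw [applyLocal_zero, applyLocal_applyLocal] at this
    convert this using 2
    funext j
    by_cases hj : j = p
    · subst hj; simp
    · simp [Function.update_of_ne hj, Matrix.nonsing_inv_mul _ (hG j hj)]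
  ext a k
  have h2 := congrArg (fun ψ : QState 3 3 => ψ.ofLp (Function.update (Equiv.swap p k) p a)) h1
  simp only [A3, applyLocal_antisymmState, PiLp.zero_apply] at h2
  have h3 := (mul_eq_zero.1 h2).resolve_left (by
    simp [Nat.factorial_ne_zero])
  fin_cases p <;> fin_cases k <;>
    simpa [Matrix.det_fin_three, Matrix.one_apply, Function.update, Equiv.swap_apply_def] using h3

/-- A linear relation between the rows of one operator would kill a contraction of the state,
but `|A₃⟩` has no vanishing contraction. -/
theorem isUnit_det_of_proportional_A3 {A : Fin 3 → Matrix (Fin 3) (Fin 3) ℂ}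
    (h : Proportional (applyLocal A A3) A3) (p : Fin 3) : IsUnit (A p).det := by
  rw [isUnit_iff_ne_zero]
  intro hdet
  obtain ⟨v, hv, hvA⟩ := Matrix.exists_vecMul_eq_zero_iff.2 hdet
  obtain ⟨c, hc, hA⟩ := h
  have hV : Matrix.of (fun _ : Fin 3 => v) * A p = 0 := by
    ext i j
    exact congrFun hvA j
  have h0 : applyLocal (Function.update (fun _ => 1) p (Matrix.of fun _ : Fin 3 => v)) A3 = 0 := by
    have h1 := congrArg
      (applyLocal (Function.update (fun _ => 1) p (Matrix.of fun _ : Fin 3 => v))) hA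
    rw [applyLocal_smul, applyLocal_applyLocal] at h1
    refine (smul_eq_zero.1 (h1.symm.trans ?_)).resolve_left hc
    ext x
    simp only [applyLocal, localOp, Matrix.mulVec, dotProduct, Matrix.of_apply, PiLp.zero_apply]
    refine Finset.sum_eq_zero fun y _ => mul_eq_zero_of_left (Finset.prod_eq_zero
      (Finset.mem_univ p) ?_) _
    simp [hV]
  have := applyLocal_update_antisymmState_eq_zero (G := fun _ => 1) (by simp) h0
  exact hv (congrFun this 0)

theorem antisymm_coord {A : Fin 3 → Matrix (Fin 3) (Fin 3) ℂ} {c : ℂ}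
    (h : applyLocal A A3 = c • A3) (x : Fin 3 → Fin 3) :
    (Matrix.of fun i j => A i (x i) j).det =
      c * (Matrix.of fun i j => if x i = j then 1 else 0 : Matrix (Fin 3) (Fin 3) ℂ).det := by
  have h1 := congrArg (fun ψ : QState 3 3 => ψ.ofLp x) h
  have h2 : A3 = applyLocal (fun _ => 1) A3 := (applyLocal_one _).symm
  rw [h2, applyLocal_applyLocal] at h1
  simp only [A3, applyLocal_antisymmState, PiLp.smul_apply, smul_eq_mul, mul_one,
    Matrix.one_apply] at h1
  rw [mul_left_comm] at h1
  exact mul_left_cancel₀ (by simp [Nat.factorial_ne_zero]) h1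

/-- If `A ⊗ B ⊗ 𝟙` fixes the ray of `|A₃⟩`, then `A` and `B` are scalar. With `E` the
antisymmetric matrix of any slice of `|A₃⟩`, the hypothesis reads `A E Bᵀ = c E`, hence
`A E = E C` for a single matrix `C`; comparing entries forces `A = C` to be scalar. -/
theorem scalar_of_stabilizes_A3 {A B : Matrix (Fin 3) (Fin 3) ℂ} (hB : IsUnit B.det) {c : ℂ}
    (hc : c ≠ 0) (h : applyLocal ![A, B, 1] A3 = c • A3) :
    (∃ a : ℂ, A = a • 1) ∧ ∃ b : ℂ, B = b • 1 := by
  have key := antisymm_coord h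
  obtain ⟨C, hC⟩ : ∃ C, C * Bᵀ = c • (1 : Matrix (Fin 3) (Fin 3) ℂ) :=
    ⟨c • (Bᵀ)⁻¹, by rw [Matrix.smul_mul, Matrix.nonsing_inv_mul _ (by simpa using hB)]⟩
  have hcancel : ∀ X Y : Matrix (Fin 3) (Fin 3) ℂ, X * Bᵀ = Y * Bᵀ → X = Y := by
    intro X Y hXY
    have := congrArg (· * (Bᵀ)⁻¹) hXY
    simpa [Matrix.mul_assoc, Matrix.mul_nonsing_inv _ (show IsUnit Bᵀ.det by simpa using hB)]
      using this
  have slice : ∀ E : Matrix (Fin 3) (Fin 3) ℂ, A * E * Bᵀ = c • E → A * E = E * C := by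
    intro E hE
    apply hcancel
    rw [hE, Matrix.mul_assoc, hC, Matrix.mul_smul, Matrix.mul_one]
  have h0 : A * !![0, 0, 0; 0, 0, 1; 0, -1, 0] = !![0, 0, 0; 0, 0, 1; 0, -1, 0] * C := by
    refine slice _ ?_
    have k := fun a b => key ![a, b, 0]
    rw [← Matrix.ext_iff]
    simp only [Matrix.det_fin_three, Matrix.of_apply, Matrix.cons_val, Matrix.one_apply] at k
    simp [Matrix.mul_apply, Fin.sum_univ_three, Fin.forall_fin_succ] at k ⊢
    grind
  have h1 : A * !![0, 0, -1; 0, 0, 0; 1, 0, 0] = !![0, 0, -1; 0, 0, 0; 1, 0, 0] * C := by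
    refine slice _ ?_
    have k := fun a b => key ![a, b, 1]
    rw [← Matrix.ext_iff]
    simp only [Matrix.det_fin_three, Matrix.of_apply, Matrix.cons_val, Matrix.one_apply] at k
    simp [Matrix.mul_apply, Fin.sum_univ_three, Fin.forall_fin_succ] at k ⊢
    grind
  have h2 : A * !![0, 1, 0; -1, 0, 0; 0, 0, 0] = !![0, 1, 0; -1, 0, 0; 0, 0, 0] * C := by
    refine slice _ ?_
    have k := fun a b => key ![a, b, 2]
    rw [← Matrix.ext_iff]
    simp only [Matrix.det_fin_three, Matrix.of_apply, Matrix.cons_val, Matrix.one_apply] at k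
    simp [Matrix.mul_apply, Fin.sum_univ_three, Fin.forall_fin_succ] at k ⊢
    grind
  have e0 := fun a b => congrFun (congrFun h0 a) b
  have e1 := fun a b => congrFun (congrFun h1 a) b
  have e2 := fun a b => congrFun (congrFun h2 a) b
  simp [Matrix.mul_apply, Fin.sum_univ_three, Fin.forall_fin_succ] at e0 e1 e2
  have hA : A = A 0 0 • 1 := by
    rw [← Matrix.ext_iff]
    simp [Fin.forall_fin_succ, Matrix.one_apply]
    grind
  have hCA : C = A 0 0 • 1 := by
    rw [← Matrix.ext_iff]
    simp [Fin.forall_fin_succ, Matrix.one_apply]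
    grind
  refine ⟨⟨_, hA⟩, c / A 0 0, ?_⟩
  rw [hCA, Matrix.smul_mul, Matrix.one_mul] at hC
  have ha : A 0 0 ≠ 0 := by
    intro ha
    rw [ha, zero_smul] at hC
    exact smul_ne_zero hc one_ne_zero hC.symm
  rw [← Matrix.transpose_transpose B, ← inv_smul_smul₀ ha Bᵀ, hC, smul_smul,
    Matrix.transpose_smul, Matrix.transpose_one, div_eq_inv_mul]

/-- The stabilizer of the ray of `|A₃⟩` consists of the operators `S ⊗ S ⊗ S` up to a factor;
consequently two operators produce the same ray only if they differ by such an operator. -/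
theorem exists_of_proportional_A3 {A h : Fin 3 → Matrix (Fin 3) (Fin 3) ℂ}
    (hh : ∀ i, IsUnit (h i).det) (hA : Proportional (applyLocal A A3) (applyLocal h A3)) :
    ∃ S : Matrix (Fin 3) (Fin 3) ℂ, IsUnit S.det ∧ ∃ t : Fin 3 → ℂ, (∀ i, t i ≠ 0) ∧
      ∀ i, A i = t i • (h i * S) := by
  have h1 := hA.applyLocal (fun i => (h i)⁻¹)
  rw [applyLocal_applyLocal, applyLocal_applyLocal] at h1
  simp only [Matrix.nonsing_inv_mul _ (hh _), applyLocal_one] at h1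
  set B := fun i => (h i)⁻¹ * A i with hBdef
  have hB := isUnit_det_of_proportional_A3 h1
  obtain ⟨c, hc, hcB⟩ := h1
  have h2 : applyLocal ![B 0 * (B 2)⁻¹, B 1 * (B 2)⁻¹, 1] A3 = ((B 2)⁻¹.det * c) • A3 := by
    rw [mul_smul, ← hcB, A3, ← applyLocal_mul_right_antisymmState]
    congr 1
    funext i
    fin_cases i <;> simp [Matrix.mul_nonsing_inv _ (hB 2)]
  have u : IsUnit (B 2)⁻¹.det := Matrix.isUnit_nonsing_inv_det _ (hB 2)
  obtain ⟨⟨a, ha⟩, b, hb⟩ := scalar_of_stabilizes_A3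
    (by rw [Matrix.det_mul]; exact (hB 1).mul u) (mul_ne_zero u.ne_zero hc) h2
  have back : ∀ i (t : ℂ), B i * (B 2)⁻¹ = t • 1 → t ≠ 0 ∧ A i = t • (h i * B 2) := by
    intro i t ht
    have hBi : B i = t • B 2 := by
      rw [← Matrix.mul_one (B i), ← Matrix.nonsing_inv_mul _ (hB 2), ← Matrix.mul_assoc, ht]
      simp
    refine ⟨?_, ?_⟩
    · rintro rfl
      have := hB i
      rw [hBi] at this
      simp at this
    · rw [← Matrix.mul_smul, ← hBi, hBdef, ← Matrix.mul_assoc, Matrix.mul_nonsing_inv _ (hh i),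
        Matrix.one_mul]
  refine ⟨B 2, hB 2, ![a, b, 1], ?_, ?_⟩
  rotate_left
  · intro i
    fin_cases i
    · exact (back 0 a ha).2
    · exact (back 1 b hb).2
    · exact (back 2 1 (by rw [Matrix.mul_nonsing_inv _ (hB 2), one_smul])).2
  · intro i
    fin_cases i
    · exact (back 0 a ha).1
    · exact (back 1 b hb).1
    · exact one_ne_zero

/-! ### Gram matrices and local unitary equivalence -/

/-- The Gram matrices `Aᴴ A` and `Bᴴ B` agree up to a positive factor. -/
def GramProp {d : ℕ} (A B : Matrix (Fin d) (Fin d) ℂ) : Prop :=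
  ∃ c : ℝ, 0 < c ∧ Aᴴ * A = (c : ℂ) • (Bᴴ * B)

/-- The tuples of Gram matrices of `A` and `h` agree up to positive factors and a common change
of basis `S`. -/
def GramEquiv {n d : ℕ} (A h : Fin n → Matrix (Fin d) (Fin d) ℂ) : Prop :=
  ∃ S : Matrix (Fin d) (Fin d) ℂ, IsUnit S.det ∧ ∀ i, GramProp (A i) (h i * S)

theorem GramProp.symm {d : ℕ} {A B : Matrix (Fin d) (Fin d) ℂ} (h : GramProp A B) :
    GramProp B A := by
  obtain ⟨c, hc, e⟩ := h
  refine ⟨c⁻¹, inv_pos.2 hc, ?_⟩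
  rw [e, smul_smul, ← Complex.ofReal_mul, inv_mul_cancel₀ hc.ne', Complex.ofReal_one, one_smul]

theorem GramProp.trans {d : ℕ} {A B C : Matrix (Fin d) (Fin d) ℂ} (h : GramProp A B)
    (h' : GramProp B C) : GramProp A C := by
  obtain ⟨c, hc, e⟩ := h
  obtain ⟨c', hc', e'⟩ := h'
  refine ⟨c * c', mul_pos hc hc', ?_⟩
  rw [e, e', smul_smul, Complex.ofReal_mul]

theorem gram_mul {d : ℕ} (A S : Matrix (Fin d) (Fin d) ℂ) :
    (A * S)ᴴ * (A * S) = Sᴴ * (Aᴴ * A) * S := by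
  rw [Matrix.conjTranspose_mul]
  simp only [Matrix.mul_assoc]

theorem gram_unitary_mul {d : ℕ} (U : Matrix.unitaryGroup (Fin d) ℂ)
    (A : Matrix (Fin d) (Fin d) ℂ) :
    ((U : Matrix (Fin d) (Fin d) ℂ) * A)ᴴ * (U * A) = Aᴴ * A := by
  have hU : (U : Matrix (Fin d) (Fin d) ℂ)ᴴ * U = 1 := Matrix.UnitaryGroup.star_mul_self U
  rw [gram_mul, hU, Matrix.mul_one]

theorem gram_smul {d : ℕ} (t : ℂ) (A : Matrix (Fin d) (Fin d) ℂ) :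
    (t • A)ᴴ * (t • A) = ((‖t‖ ^ 2 : ℝ) : ℂ) • (Aᴴ * A) := by
  rw [Matrix.conjTranspose_smul, Matrix.smul_mul, Matrix.mul_smul, smul_smul]
  congr 1
  push_cast
  exact Complex.conj_mul' t

theorem GramProp.mul_right {d : ℕ} {A B : Matrix (Fin d) (Fin d) ℂ} (h : GramProp A B)
    (S : Matrix (Fin d) (Fin d) ℂ) : GramProp (A * S) (B * S) := by
  obtain ⟨c, hc, e⟩ := h
  refine ⟨c, hc, ?_⟩
  rw [gram_mul, gram_mul, e, Matrix.mul_smul, Matrix.smul_mul]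

theorem gramProp_unitary_mul {d : ℕ} (U : Matrix.unitaryGroup (Fin d) ℂ)
    (A : Matrix (Fin d) (Fin d) ℂ) : GramProp ((U : Matrix (Fin d) (Fin d) ℂ) * A) A :=
  ⟨1, one_pos, by rw [gram_unitary_mul, Complex.ofReal_one, one_smul]⟩

theorem isUnit_det_of_gram_eq {d : ℕ} {A B : Matrix (Fin d) (Fin d) ℂ}
    (h : Aᴴ * A = Bᴴ * B) (hB : IsUnit B.det) : IsUnit A.det := by
  have h1 := congrArg Matrix.det h
  rw [Matrix.det_mul, Matrix.det_mul, Matrix.det_conjTranspose, Matrix.det_conjTranspose] at h1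
  rw [isUnit_iff_ne_zero] at hB ⊢
  intro h0
  rw [h0, mul_zero] at h1
  simp [hB] at h1

theorem GramProp.isUnit_det {d : ℕ} {A B : Matrix (Fin d) (Fin d) ℂ} (h : GramProp A B)
    (hB : IsUnit B.det) : IsUnit A.det := by
  obtain ⟨c, hc, e⟩ := h
  refine isUnit_det_of_gram_eq (B := ((√c : ℝ) : ℂ) • B) ?_ ?_
  · rw [gram_smul, e]
    congr 2
    rw [Complex.norm_real, Real.norm_eq_abs, sq_abs, Real.sq_sqrt hc.le]
  · rw [Matrix.det_smul]
    refine IsUnit.mul (IsUnit.pow _ ?_) hB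
    simpa [isUnit_iff_ne_zero] using (Real.sqrt_pos.2 hc).ne'

/-- Invertible matrices with equal Gram matrices differ by a unitary on the left. -/
theorem exists_unitary_mul_eq {d : ℕ} {A B : Matrix (Fin d) (Fin d) ℂ}
    (h : Bᴴ * B = Aᴴ * A) (hA : IsUnit A.det) :
    ∃ U : Matrix.unitaryGroup (Fin d) ℂ, (U : Matrix (Fin d) (Fin d) ℂ) * A = B := by
  refine ⟨⟨B * A⁻¹, ?_⟩, ?_⟩
  · rw [Matrix.mem_unitaryGroup_iff', Matrix.star_eq_conjTranspose, gram_mul, h, ← gram_mul,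
      Matrix.mul_nonsing_inv _ hA]
    simp
  · change B * A⁻¹ * A = B
    rw [Matrix.mul_assoc, Matrix.nonsing_inv_mul _ hA, Matrix.mul_one]

/-- Operators that produce the same ray have equivalent Gram matrices. -/
theorem gramEquiv_of_proportional {A h : Fin 3 → Matrix (Fin 3) (Fin 3) ℂ}
    (hh : ∀ i, IsUnit (h i).det) (hA : Proportional (applyLocal A A3) (applyLocal h A3)) :
    GramEquiv A h := by
  obtain ⟨S, hS, t, ht, hAt⟩ := exists_of_proportional_A3 hh hA
  refine ⟨S, hS, fun i => ⟨‖t i‖ ^ 2, by have := norm_pos_iff.2 (ht i); positivity, ?_⟩⟩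
  rw [hAt, gram_smul]

/-- Operators with equivalent Gram matrices produce locally unitarily equivalent states. -/
theorem GramEquiv.luEquiv {A h : Fin 3 → Matrix (Fin 3) (Fin 3) ℂ}
    (hh : ∀ i, IsUnit (h i).det) (hA : GramEquiv A h) :
    LUEquiv (applyLocal A A3) (applyLocal h A3) := by
  obtain ⟨S, hS, hg⟩ := hA
  have hAu : ∀ i, IsUnit (A i).det := fun i =>
    (hg i).isUnit_det (by rw [Matrix.det_mul]; exact (hh i).mul hS)
  choose c hc e using hg
  have : ∀ i, ∃ U : Matrix.unitaryGroup (Fin 3) ℂ,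
      (U : Matrix (Fin 3) (Fin 3) ℂ) * A i = ((√(c i) : ℝ) : ℂ) • (h i * S) := by
    intro i
    refine exists_unitary_mul_eq ?_ (hAu i)
    rw [gram_smul, e, Complex.norm_real, Real.norm_eq_abs, sq_abs, Real.sq_sqrt (hc i).le]
  choose U hU using this
  refine ⟨U, Proportional.symm ⟨(∏ i, ((√(c i) : ℝ) : ℂ)) * S.det, ?_, ?_⟩⟩
  · refine mul_ne_zero (Finset.prod_ne_zero_iff.2 fun i _ => ?_) hS.ne_zero
    exact_mod_cast (Real.sqrt_pos.2 (hc i)).ne'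
  · rw [applyLocal_applyLocal]
    simp only [hU]
    rw [applyLocal_smul_left, A3, applyLocal_mul_right_antisymmState, smul_smul]

/-! ### Balanced diagonal states -/

/-- The condition on the (positive) diagonals `d i` of the Gram matrices singled out by the three
types: if for two indices the diagonals of two parties have the same ratio, then so have those of
all parties. It is invariant under rescaling each party and each index. -/
def IsBalanced (d : Fin 3 → Fin 3 → ℝ) : Prop :=
  ∀ a b i j, i ≠ j → d i a * d j b = d i b * d j a → ∀ p, d i a * d p b = d i b * d p a

/-- The diagonal operators with Gram matrices `diag (d i)`. -/
def diagOps (d : Fin 3 → Fin 3 → ℝ) (i : Fin 3) : Matrix (Fin 3) (Fin 3) ℂ :=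
  Matrix.diagonal fun a => ((√(d i a) : ℝ) : ℂ)

theorem gram_diagOps {d : Fin 3 → Fin 3 → ℝ} (hd : ∀ i a, 0 < d i a) (i : Fin 3) :
    (diagOps d i)ᴴ * diagOps d i = Matrix.diagonal fun a => ((d i a : ℝ) : ℂ) := by
  rw [diagOps, Matrix.diagonal_conjTranspose, Matrix.diagonal_mul_diagonal]
  congr 1
  funext a
  simp only [Pi.star_apply, Complex.star_def, Complex.conj_ofReal]
  rw [← Complex.ofReal_mul, Real.mul_self_sqrt (hd i a).le]

theorem isUnit_det_diagOps {d : Fin 3 → Fin 3 → ℝ} (hd : ∀ i a, 0 < d i a) (i : Fin 3) :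
    IsUnit (diagOps d i).det := by
  rw [diagOps, Matrix.det_diagonal, isUnit_iff_ne_zero, Finset.prod_ne_zero_iff]
  intro a _
  exact_mod_cast (Real.sqrt_pos.2 (hd i a)).ne'

/-- A change of basis that fixes two of the three Gram matrices, up to factors, of a balanced
diagonal state fixes the third as well: comparing traces, it commutes with the ratio of the first
two, hence, by balancedness, with the ratio of any two. -/
theorem IsBalanced.gramProp {d : Fin 3 → Fin 3 → ℝ} (hd : ∀ i a, 0 < d i a) (hb : IsBalanced d)
    {p : Fin 3} {T : Matrix (Fin 3) (Fin 3) ℂ} (hT : IsUnit T.det)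
    (h : ∀ j ≠ p, GramProp (diagOps d j * T) (diagOps d j)) :
    GramProp (diagOps d p * T) (diagOps d p) := by
  obtain ⟨i, j, hij, hi, hj⟩ : ∃ i j : Fin 3, i ≠ j ∧ i ≠ p ∧ j ≠ p := by
    clear h
    revert p; decide
  obtain ⟨c, hc, ec⟩ := h i hi
  obtain ⟨c', hc', ec'⟩ := h j hj
  rw [gram_mul, gram_diagOps hd] at ec ec'
  set D : Fin 3 → Matrix (Fin 3) (Fin 3) ℂ := fun k => Matrix.diagonal fun a => ((d k a : ℝ) : ℂ)
    with hD
  have dne : ∀ k a, (d k a : ℂ) ≠ 0 := fun k a => by exact_mod_cast (hd k a).ne'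
  -- `R k` is the ratio of the Gram matrices of the parties `k` and `i`
  set R : Fin 3 → Matrix (Fin 3) (Fin 3) ℂ :=
    fun k => Matrix.diagonal fun a => (d k a : ℂ) / (d i a : ℂ) with hR
  have hDR : ∀ k, D k = D i * R k := by
    intro k
    simp only [hD, hR, Matrix.diagonal_mul_diagonal]
    congr 1
    funext a
    rw [mul_div_cancel₀ _ (dne i a)]
  have hDi : IsUnit (D i).det := by
    simp only [hD, Matrix.det_diagonal, isUnit_iff_ne_zero, Finset.prod_ne_zero_iff]
    exact fun a _ => dne i a
  have hcancel : IsUnit (Tᴴ * D i).det := by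
    rw [Matrix.det_mul, Matrix.det_conjTranspose]
    exact (hT.star).mul hDi
  have e1 : R j * T = ((c' / c : ℝ) : ℂ) • (T * R j) := by
    have h1 : (Tᴴ * D i) * (R j * T) = (Tᴴ * D i) * (((c' / c : ℝ) : ℂ) • (T * R j)) := by
      calc (Tᴴ * D i) * (R j * T) = Tᴴ * (D i * R j) * T := by simp only [Matrix.mul_assoc]
        _ = (c' : ℂ) • (D i * R j) := by rw [← hDR]; exact ec'
        _ = ((c' / c : ℝ) : ℂ) • (((c : ℂ) • D i) * R j) := by
          rw [Matrix.smul_mul, smul_smul, ← Complex.ofReal_mul, div_mul_cancel₀ _ hc.ne']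
        _ = (Tᴴ * D i) * (((c' / c : ℝ) : ℂ) • (T * R j)) := by
          rw [← ec]; simp only [Matrix.mul_assoc, Matrix.mul_smul]; rfl
    have h2 := congrArg ((Tᴴ * D i)⁻¹ * ·) h1
    simpa only [← Matrix.mul_assoc, Matrix.nonsing_inv_mul _ hcancel, Matrix.one_mul] using h2
  have hκ : ((c' / c : ℝ) : ℂ) = 1 := by
    have h1 : T⁻¹ * (R j * T) = ((c' / c : ℝ) : ℂ) • R j := by
      rw [e1, Matrix.mul_smul, ← Matrix.mul_assoc, Matrix.nonsing_inv_mul _ hT, Matrix.one_mul]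
    have h2 := congrArg Matrix.trace h1
    rw [Matrix.trace_mul_comm, Matrix.mul_assoc, Matrix.mul_nonsing_inv _ hT, Matrix.mul_one,
      Matrix.trace_smul, smul_eq_mul] at h2
    have h3 : (R j).trace ≠ 0 := by
      have : (R j).trace = ((∑ a, d j a / d i a : ℝ) : ℂ) := by
        simp [hR, Matrix.trace_diagonal]
      rw [this]
      exact_mod_cast (Finset.sum_pos (fun a _ => div_pos (hd j a) (hd i a))
        Finset.univ_nonempty).ne'
    exact mul_right_cancel₀ h3 (by rw [one_mul]; exact h2.symm)
  have e2 : R p * T = T * R p := by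
    rw [hκ, one_smul] at e1
    ext a b
    have h1 := congrFun (congrFun e1 a) b
    simp only [hR, Matrix.diagonal_mul, Matrix.mul_diagonal] at h1 ⊢
    by_cases hab : T a b = 0
    · simp [hab]
    · rw [mul_comm] at h1
      have h2 := mul_left_cancel₀ hab h1
      rw [div_eq_div_iff (dne i a) (dne i b)] at h2
      have h3 : d i a * d j b = d i b * d j a := by
        have : d j a * d i b = d j b * d i a := by exact_mod_cast h2
        linarith
      have h4 := hb a b i j hij h3 p
      rw [mul_comm]
      congr 1
      rw [div_eq_div_iff (dne i a) (dne i b)]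
      have : d p a * d i b = d p b * d i a := by linarith
      exact_mod_cast this
  refine ⟨c, hc, ?_⟩
  rw [gram_mul, gram_diagOps hd]
  change Tᴴ * D p * T = (c : ℂ) • D p
  rw [hDR p, ← Matrix.mul_assoc, Matrix.mul_assoc _ (R p), e2, ← Matrix.mul_assoc,
    show Tᴴ * D i * T = (c : ℂ) • D i from ec, Matrix.smul_mul]

/-! ### Rigid states are not reachable by finitely many rounds -/

/-- If each Gram matrix of `h` is fixed, up to a factor, by every change of basis that fixes the
two others, then any product operator whose state is transformed into that of `h` by finitely many
rounds has equivalent Gram matrices. By induction, all branches of the first round have such Gram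
matrices; rigidity makes their changes of basis interchangeable, and the Gram matrix of the
measuring party is recovered by summing over the outcomes. -/
theorem gramEquiv_of_transforms {h : Fin 3 → Matrix (Fin 3) (Fin 3) ℂ}
    (hh : ∀ i, IsUnit (h i).det)
    (rigid : ∀ (p : Fin 3) (T : Matrix (Fin 3) (Fin 3) ℂ), IsUnit T.det →
      (∀ j ≠ p, GramProp (h j * T) (h j)) → GramProp (h p * T) (h p))
    {φ : QState 3 3} (hφ : Proportional φ (applyLocal h A3)) (r : ℕ) :
    ∀ (P : Protocol 3 3) (A : Fin 3 → Matrix (Fin 3) (Fin 3) ℂ), applyLocal A A3 ≠ 0 →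
      P.Transforms r (applyLocal A A3) φ → GramEquiv A h := by
  induction r with
  | zero =>
    intro P A _ hP
    exact gramEquiv_of_proportional hh (Proportional.trans hP hφ)
  | succ r ih =>
    intro P A hA hP
    have branch_eq : ∀ k, (P []).branch k (applyLocal A A3) = applyLocal
        (Function.update (fun j => ((P []).unitaries k j : Matrix (Fin 3) (Fin 3) ℂ) * A j)
          (P []).party ((P []).kraus k * A (P []).party)) A3 := by
      intro k
      rw [Round.branch, applyLocal_applyLocal]
      congr 1
      funext j
      by_cases hj : j = (P []).party
      · subst hj; simp
      · simp [Function.update_of_ne hj]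
    set p := (P []).party with hp
    have step : ∀ k, (P []).branch k (applyLocal A A3) ≠ 0 →
        ∃ S : Matrix (Fin 3) (Fin 3) ℂ, IsUnit S.det ∧ (∀ j ≠ p, GramProp (A j) (h j * S)) ∧
          GramProp ((P []).kraus k * A p) (h p * S) := by
      intro k hk
      have hPk := hP k hk
      rw [branch_eq] at hk hPk
      obtain ⟨S, hS, hg⟩ := ih _ _ hk hPk
      refine ⟨S, hS, fun j hj => ?_, by simpa using hg p⟩
      have := hg j
      rw [Function.update_of_ne hj] at this
      exact (gramProp_unitary_mul ((P []).unitaries k j) (A j)).symm.trans this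
    obtain ⟨k₀, hk₀⟩ := (P []).exists_branch_ne_zero hA
    obtain ⟨S, hS, hSj, hSp⟩ := step k₀ hk₀
    have hAj : ∀ j ≠ p, IsUnit (A j).det := fun j hj =>
      (hSj j hj).isUnit_det (by rw [Matrix.det_mul]; exact (hh j).mul hS)
    have all : ∀ k, ∃ c : ℝ, 0 ≤ c ∧ (k = k₀ → 0 < c) ∧
        ((P []).kraus k * A p)ᴴ * ((P []).kraus k * A p) =
          (c : ℂ) • ((h p * S)ᴴ * (h p * S)) := by
      intro k
      by_cases hk : (P []).branch k (applyLocal A A3) = 0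
      · refine ⟨0, le_rfl, fun hkk => absurd (hkk ▸ hk) hk₀, ?_⟩
        rw [branch_eq] at hk
        have h0 : (P []).kraus k * A p = 0 := by
          refine applyLocal_update_antisymmState_eq_zero (fun j hj => ?_) hk
          rw [Matrix.det_mul]
          exact (Matrix.UnitaryGroup.det_isUnit _).mul (hAj j hj)
        rw [h0]
        simp
      · obtain ⟨S', hS', hSj', hSp'⟩ := step k hk
        have hcan : ∀ j, h j * (S' * S⁻¹) * S = h j * S' := by
          intro j
          rw [Matrix.mul_assoc, Matrix.mul_assoc, Matrix.nonsing_inv_mul _ hS, Matrix.mul_one]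
        have hcan' : ∀ j, h j * S * S⁻¹ = h j := by
          intro j
          rw [Matrix.mul_assoc, Matrix.mul_nonsing_inv _ hS, Matrix.mul_one]
        have hT := rigid p (S' * S⁻¹)
          (by rw [Matrix.det_mul]; exact hS'.mul (Matrix.isUnit_nonsing_inv_det _ hS)) (by
            intro j hj
            have := ((hSj' j hj).symm.trans (hSj j hj)).mul_right S⁻¹
            rwa [hcan', Matrix.mul_assoc] at this)
        have := hT.mul_right S
        rw [hcan] at this
        obtain ⟨c, hc, e⟩ := hSp'.trans this
        exact ⟨c, hc.le, fun _ => hc, e⟩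
    choose c hc0 hck hce using all
    refine ⟨S, hS, fun j => ?_⟩
    by_cases hj : j = p
    · subst hj
      refine ⟨∑ k, c k, Finset.sum_pos' (fun k _ => hc0 k) ⟨k₀, Finset.mem_univ _, hck k₀ rfl⟩, ?_⟩
      have hsum : (A p)ᴴ * A p =
          ∑ k, ((P []).kraus k * A p)ᴴ * ((P []).kraus k * A p) := by
        simp only [gram_mul]
        rw [← Finset.sum_mul, ← Finset.mul_sum, (P []).complete, Matrix.mul_one]
      rw [hsum, Finset.sum_congr rfl fun k _ => hce k, ← Finset.sum_smul, Complex.ofReal_sum]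
    · exact hSj j hj

/-! ### The three types are the balanced diagonal states -/

theorem LUEquiv.trans_proportional {n d : ℕ} {ψ φ χ : QState n d} (h : LUEquiv ψ φ)
    (h' : Proportional χ φ) : LUEquiv ψ χ := by
  obtain ⟨U, hU⟩ := h
  exact ⟨U, h'.trans hU⟩

theorem applyLocal_mem_SLOCCClass {n d : ℕ} {A : Fin n → Matrix (Fin d) (Fin d) ℂ}
    (hA : ∀ i, IsUnit (A i).det) (ψ : QState n d) : applyLocal A ψ ∈ SLOCCClass ψ :=
  ⟨fun i => Matrix.GeneralLinearGroup.mk'' (A i) (hA i), rfl⟩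

theorem isUnit_det_GL {d : ℕ} (g : GL (Fin d) ℂ) :
    IsUnit (g : Matrix (Fin d) (Fin d) ℂ).det :=
  (Matrix.isUnit_iff_isUnit_det _).1 g.isUnit

theorem applyLocal_A3_ne_zero {A : Fin 3 → Matrix (Fin 3) (Fin 3) ℂ}
    (hA : ∀ i, IsUnit (A i).det) : applyLocal A A3 ≠ 0 := by
  intro h
  have h0 : A 0 = 0 := by
    refine applyLocal_update_antisymmState_eq_zero (p := 0) (G := A) (fun j _ => hA j) ?_
    rwa [Function.update_eq_self]
  have := hA 0
  rw [h0] at this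
  simp at this

/-- Permuting the basis, rescaling the basis vectors and rescaling the parties does not change a
diagonal state up to local unitaries. -/
theorem gramEquiv_diagOps {d e : Fin 3 → Fin 3 → ℝ} (hd : ∀ i a, 0 < d i a)
    {c s : Fin 3 → ℝ} (hc : ∀ i, 0 < c i) (hs : ∀ a, 0 < s a) (σ : Equiv.Perm (Fin 3))
    (he : ∀ i a, e i a = c i * s a * d i (σ a)) : GramEquiv (diagOps e) (diagOps d) := by
  have hep : ∀ i a, 0 < e i a := fun i a => by
    rw [he]; exact mul_pos (mul_pos (hc i) (hs a)) (hd _ _)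
  refine ⟨(1 : Matrix (Fin 3) (Fin 3) ℂ).submatrix id σ *
    Matrix.diagonal fun a => ((√(s a) : ℝ) : ℂ), ?_, fun i => ⟨c i, hc i, ?_⟩⟩
  · rw [Matrix.det_mul, Matrix.det_permute', Matrix.det_one, mul_one, Matrix.det_diagonal,
      isUnit_iff_ne_zero]
    refine mul_ne_zero (by exact_mod_cast (Equiv.Perm.sign σ).ne_zero)
      (Finset.prod_ne_zero_iff.2 fun a _ => ?_)
    exact_mod_cast (Real.sqrt_pos.2 (hs a)).ne'
  · rw [gram_mul, gram_diagOps hep, gram_diagOps hd]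
    ext a b
    simp only [Matrix.smul_apply, Matrix.mul_apply, Matrix.diagonal_apply, Matrix.submatrix_apply,
      Matrix.conjTranspose_apply, Matrix.one_apply, id]
    by_cases hab : a = b
    · subst hab
      simp [he]
      rw [mul_comm (√(s a) : ℂ), mul_assoc (d i (σ a) : ℂ), ← Complex.ofReal_mul (√(s a)),
        Real.mul_self_sqrt (hs a).le]
      ring
    · simp [hab, Ne.symm hab]

theorem diagState_eq (α₁ β₁ α₂ β₂ : ℝ) : diagState α₁ β₁ α₂ β₂ =
    applyLocal (diagOps ![![α₁, β₁, 1], ![α₂, β₂, 1], ![1, 1, 1]]) A3 := by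
  rw [diagState]
  congr 1
  funext i
  fin_cases i
  · exact congrArg Matrix.diagonal (by funext a; fin_cases a <;> simp)
  · exact congrArg Matrix.diagonal (by funext a; fin_cases a <;> simp)
  · exact Matrix.diagonal_one.symm.trans
      (congrArg Matrix.diagonal (by funext a; fin_cases a <;> simp))

theorem diagState_one : diagState 1 1 1 1 = A3 := by
  rw [diagState_eq]
  conv_rhs => rw [← applyLocal_one A3]
  congr 1
  funext i
  refine (congrArg Matrix.diagonal ?_).trans Matrix.diagonal_one
  funext a
  fin_cases i <;> fin_cases a <;> simp

/-- A diagonal tuple is balanced as soon as its columns are pairwise proportional or pairwise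
without any coinciding ratio. -/
theorem isBalanced_of_pairs {d : Fin 3 → Fin 3 → ℝ}
    (h : ∀ a b, a < b → (∀ i j, d i a * d j b = d i b * d j a) ∨
      ∀ i j, i ≠ j → d i a * d j b ≠ d i b * d j a) : IsBalanced d := by
  intro a b i j hij hab p
  rcases lt_trichotomy a b with hlt | rfl | hlt
  · rcases h a b hlt with h1 | h1
    · exact h1 i p
    · exact absurd hab (h1 i j hij)
  · rfl
  · rcases h b a hlt with h1 | h1
    · exact (h1 i p).symm
    · exact absurd hab.symm (h1 i j hij)

theorem exists_balanced_of_type {ψ : QState 3 3}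
    (h : IsTypeI ψ ∨ IsTypeII ψ ∨ IsTypeIII ψ) :
    ∃ d : Fin 3 → Fin 3 → ℝ, (∀ i a, 0 < d i a) ∧ IsBalanced d ∧
      Proportional ψ (applyLocal (diagOps d) A3) := by
  rcases h with h | ⟨α₁, α₂, h1, h2, h12, h1', h2', h⟩ |
    ⟨α₁, β₁, α₂, β₂, ha1, hb1, ha2, hb2, h1, h2, h3, h4, h5, h6, h7, h8, h9, h⟩
  · rw [IsTypeI, ← diagState_one, diagState_eq] at h
    refine ⟨_, ?_, ?_, h⟩
    · simp [Fin.forall_fin_succ]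
    · exact isBalanced_of_pairs fun a b _ => Or.inl (by
        revert a b; simp [Fin.forall_fin_succ])
  · rw [diagState_eq] at h
    refine ⟨_, ?_, ?_, h⟩
    · simp [Fin.forall_fin_succ, h1, h2]
    · refine isBalanced_of_pairs ?_
      simp [Fin.forall_fin_succ]
      grind
  · rw [diagState_eq] at h
    rw [Ne, div_eq_div_iff hb1.ne' hb2.ne'] at h5
    refine ⟨_, ?_, ?_, h⟩
    · simp [Fin.forall_fin_succ, *]
    · refine isBalanced_of_pairs ?_
      simp [Fin.forall_fin_succ]
      grind

/-- Normalizing the third party and the last basis vector (after a permutation `σ` of the basis)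
brings a diagonal state into the form used for the three types. -/
theorem luEquiv_diagState {d : Fin 3 → Fin 3 → ℝ} (hd : ∀ i a, 0 < d i a)
    (σ : Equiv.Perm (Fin 3)) {e : Fin 3 → Fin 3 → ℝ}
    (he : ∀ i a, e i a = d i (σ a) / d 2 (σ a) * (d 2 (σ 2) / d i (σ 2))) :
    LUEquiv (diagState (e 0 0) (e 0 1) (e 1 0) (e 1 1)) (applyLocal (diagOps d) A3) := by
  have e2 : ∀ i, e i 2 = 1 := fun i => by
    have := (hd i (σ 2)).ne'
    have := (hd 2 (σ 2)).ne'
    rw [he]; field_simp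
  have e2' : ∀ a, e 2 a = 1 := fun a => by
    have := (hd 2 (σ a)).ne'
    have := (hd 2 (σ 2)).ne'
    rw [he]; field_simp
  have hE : ![![e 0 0, e 0 1, 1], ![e 1 0, e 1 1, 1], ![1, 1, 1]] = e := by
    funext i a
    fin_cases i <;> fin_cases a <;> simp [e2, e2']
  rw [diagState_eq, hE]
  refine GramEquiv.luEquiv (isUnit_det_diagOps hd) (gramEquiv_diagOps hd
    (c := fun i => d 2 (σ 2) / d i (σ 2)) (s := fun a => (d 2 (σ a))⁻¹)
    (fun i => div_pos (hd _ _) (hd _ _)) (fun a => inv_pos.2 (hd _ _)) σ fun i a => ?_)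
  rw [he, div_eq_mul_inv, div_eq_mul_inv]
  ring

/-- Every balanced diagonal state is of one of the three types up to local unitaries: the number of
pairwise nonproportional columns is one, two or three, respectively. -/
theorem IsBalanced.exists_type {d : Fin 3 → Fin 3 → ℝ} (hd : ∀ i a, 0 < d i a)
    (hb : IsBalanced d) : ∃ ψ, (IsTypeI ψ ∨ IsTypeII ψ ∨ IsTypeIII ψ) ∧
      LUEquiv ψ (applyLocal (diagOps d) A3) := by
  have pair : ∀ a b i j, i ≠ j → d i a * d j b = d i b * d j a →
      ∀ k l, d k a * d l b = d k b * d l a := by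
    intro a b i j hij h k l
    have h1 := hb a b i j hij h k
    have h2 := hb a b i j hij h l
    have : d i a * (d k a * d l b) = d i a * (d k b * d l a) := by
      linear_combination d k a * h2 - d l a * h1
    exact mul_left_cancel₀ (hd i a).ne' this
  -- the normalized entry of party `i` at index `a` relative to that of party `j`
  have entry : ∀ (σ : Equiv.Perm (Fin 3)) i j a b,
      d i (σ a) / d 2 (σ a) * (d 2 (σ b) / d i (σ b)) =
        d j (σ a) / d 2 (σ a) * (d 2 (σ b) / d j (σ b)) ↔
      d i (σ a) * d j (σ b) = d i (σ b) * d j (σ a) := by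
    intro σ i j a b
    have := (hd 2 (σ a)).ne'
    have := (hd 2 (σ b)).ne'
    have := (hd i (σ b)).ne'
    have := (hd j (σ b)).ne'
    rw [div_mul_div_comm, div_mul_div_comm, div_eq_div_iff (by positivity) (by positivity)]
    constructor
    · intro h
      have h' : (d 2 (σ a) * d 2 (σ b)) * (d i (σ a) * d j (σ b)) =
        (d 2 (σ a) * d 2 (σ b)) * (d i (σ b) * d j (σ a)) := by linear_combination h
      exact mul_left_cancel₀ (by positivity) h'
    · intro h
      linear_combination (d 2 (σ a) * d 2 (σ b)) * h
  have self : ∀ (σ : Equiv.Perm (Fin 3)) a,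
      d 2 (σ a) / d 2 (σ a) * (d 2 (σ 2) / d 2 (σ 2)) = 1 := by
    intro σ a
    rw [div_self (hd _ _).ne', div_self (hd _ _).ne', one_mul]
  have pos : ∀ (σ : Equiv.Perm (Fin 3)) i a,
      0 < d i (σ a) / d 2 (σ a) * (d 2 (σ 2) / d i (σ 2)) := fun σ i a =>
    mul_pos (div_pos (hd _ _) (hd _ _)) (div_pos (hd _ _) (hd _ _))
  by_cases hσ : ∃ σ : Equiv.Perm (Fin 3), ∀ k l, d k (σ 1) * d l (σ 2) = d k (σ 2) * d l (σ 1)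
  · obtain ⟨σ, h⟩ := hσ
    have h1 : ∀ i, d i (σ 1) / d 2 (σ 1) * (d 2 (σ 2) / d i (σ 2)) = 1 := fun i => by
      rw [← self σ 1, entry σ i 2 1 2]; exact h i 2
    have hLU := luEquiv_diagState hd σ (e := fun i a => _) (fun i a => rfl)
    rw [h1, h1] at hLU
    by_cases h0 : ∃ i j, i ≠ j ∧ d i (σ 0) * d j (σ 2) = d i (σ 2) * d j (σ 0)
    · obtain ⟨i, j, hij, h0⟩ := h0
      have h2 : ∀ i, d i (σ 0) / d 2 (σ 0) * (d 2 (σ 2) / d i (σ 2)) = 1 := fun k => by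
        rw [← self σ 0, entry σ k 2 0 2]; exact pair _ _ i j hij h0 k 2
      rw [h2, h2] at hLU
      exact ⟨_, Or.inl ⟨1, one_ne_zero, by rw [one_smul, diagState_one]⟩, hLU⟩
    · push Not at h0
      refine ⟨_, Or.inr (Or.inl ⟨_, _, pos σ 0 0, pos σ 1 0, ?_, ?_, ?_, Proportional.refl _⟩), hLU⟩
      · rw [Ne, entry σ 0 1 0 2]; exact h0 0 1 (by decide)
      · rw [Ne, ← self σ 0, entry σ 0 2 0 2]; exact h0 0 2 (by decide)
      · rw [Ne, ← self σ 0, entry σ 1 2 0 2]; exact h0 1 2 (by decide)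
  · push Not at hσ
    have hne : ∀ a b, a ≠ b → ∀ i j, i ≠ j → d i a * d j b ≠ d i b * d j a := by
      intro a b hab i j hij h
      obtain ⟨σ, rfl, rfl⟩ : ∃ σ : Equiv.Perm (Fin 3), σ 1 = a ∧ σ 2 = b := by
        clear h
        revert a b; decide
      obtain ⟨k, l, hkl⟩ := hσ σ
      exact hkl (pair _ _ i j hij h k l)
    have hLU := luEquiv_diagState hd 1 (e := fun i a => _) (fun i a => rfl)
    have n : ∀ i j a, i ≠ j → a ≠ 2 → d i a / d 2 a * (d 2 2 / d i 2) ≠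
        d j a / d 2 a * (d 2 2 / d j 2) := fun i j a hij ha => by
      rw [Ne]
      exact (entry 1 i j a 2).not.2 (hne a 2 ha i j hij)
    have n1 : ∀ i a, i ≠ 2 → a ≠ 2 → d i a / d 2 a * (d 2 2 / d i 2) ≠ 1 := fun i a hi ha => by
      have := n i 2 a hi ha
      rwa [div_self (hd _ _).ne', div_self (hd _ _).ne', one_mul] at this
    have n2 : ∀ i, i ≠ 2 → d i 0 / d 2 0 * (d 2 2 / d i 2) ≠ d i 1 / d 2 1 * (d 2 2 / d i 2) := by
      intro i hi h
      have := mul_right_cancel₀ (div_pos (hd 2 2) (hd i 2)).ne' h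
      rw [div_eq_div_iff (hd _ _).ne' (hd _ _).ne'] at this
      exact hne 0 1 (by decide) i 2 hi (by rw [this])
    refine ⟨_, Or.inr (Or.inr ⟨_, _, _, _, pos 1 0 0, pos 1 0 1, pos 1 1 0, pos 1 1 1,
      n2 0 (by decide), n 0 1 1 (by decide) (by decide), (n2 1 (by decide)).symm,
      n 0 1 0 (by decide) (by decide), ?_, n1 0 0 (by decide) (by decide),
      n1 1 0 (by decide) (by decide), n1 0 1 (by decide) (by decide),
      n1 1 1 (by decide) (by decide), Proportional.refl _⟩), hLU⟩
    have ratio : ∀ i, d i 0 / d 2 0 * (d 2 2 / d i 2) / (d i 1 / d 2 1 * (d 2 2 / d i 2)) =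
        (d i 0 / d i 1) * (d 2 1 / d 2 0) := by
      intro i
      have := (hd i 2).ne'
      have := (hd 2 2).ne'
      have := (hd i 1).ne'
      have := (hd 2 1).ne'
      have := (hd 2 0).ne'
      field_simp
    intro h
    have h' := (ratio 0).symm.trans (h.trans (ratio 1))
    have := mul_right_cancel₀ (div_pos (hd 2 1) (hd 2 0)).ne' h'
    rw [div_eq_div_iff (hd _ _).ne' (hd _ _).ne'] at this
    exact hne 0 1 (by decide) 0 1 (by decide) (by rw [this, mul_comm])

/-! ### Properties of `M_{A₃}` -/

theorem exists_balanced_of_mem_MA3 {φ : QState 3 3} (h : φ ∈ MA3) :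
    ∃ d : Fin 3 → Fin 3 → ℝ, (∀ i a, 0 < d i a) ∧ IsBalanced d ∧
      ∃ U : Fin 3 → Matrix.unitaryGroup (Fin 3) ℂ, Proportional φ
        (applyLocal (fun i => (U i : Matrix (Fin 3) (Fin 3) ℂ) * diagOps d i) A3) := by
  obtain ⟨ψ, hψ, U, hU⟩ := h
  obtain ⟨d, hd, hb, hψd⟩ := exists_balanced_of_type hψ
  refine ⟨d, hd, hb, U, hU.trans ?_⟩
  rw [← applyLocal_applyLocal]
  exact hψd.applyLocal _

theorem isUnit_det_unitary_mul_diagOps {d : Fin 3 → Fin 3 → ℝ} (hd : ∀ i a, 0 < d i a)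
    (U : Fin 3 → Matrix.unitaryGroup (Fin 3) ℂ) (i : Fin 3) :
    IsUnit ((U i : Matrix (Fin 3) (Fin 3) ℂ) * diagOps d i).det := by
  rw [Matrix.det_mul]
  exact (Matrix.UnitaryGroup.det_isUnit _).mul (isUnit_det_diagOps hd i)

theorem isUnit_det_ite_smul {A : Fin 3 → Matrix (Fin 3) (Fin 3) ℂ} (hA : ∀ i, IsUnit (A i).det)
    {c : ℂ} (hc : c ≠ 0) (p i : Fin 3) : IsUnit ((if i = p then c else 1 : ℂ) • A i).det := by
  rw [Matrix.det_smul]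
  refine (IsUnit.pow _ ?_).mul (hA i)
  split_ifs
  · exact isUnit_iff_ne_zero.2 hc
  · exact isUnit_one

theorem MA3_subset_SLOCCClass : MA3 ⊆ SLOCCClass A3 := by
  intro φ hφ
  obtain ⟨d, hd, -, U, c, hc, rfl⟩ := exists_balanced_of_mem_MA3 hφ
  rw [smul_applyLocal 0]
  exact applyLocal_mem_SLOCCClass (isUnit_det_ite_smul (isUnit_det_unitary_mul_diagOps hd U) hc 0) _

theorem not_LOCCNReachable_of_mem_MA3 {φ : QState 3 3} (hφ : φ ∈ MA3) : ¬ LOCCNReachable φ := by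
  rintro ⟨ψ, ⟨g, hg⟩, hLU, r, P, hP⟩
  obtain ⟨d, hd, hb, U, hU⟩ := exists_balanced_of_mem_MA3 hφ
  set h : Fin 3 → Matrix (Fin 3) (Fin 3) ℂ := fun i => (U i : Matrix (Fin 3) (Fin 3) ℂ) * diagOps d i
    with hh
  have hu : ∀ i, IsUnit (h i).det := isUnit_det_unitary_mul_diagOps hd U
  obtain ⟨c, hc, hφc⟩ := id hU
  have hψ : ψ = applyLocal (fun i => (if i = 0 then c else 1 : ℂ) •
      ((g i : Matrix (Fin 3) (Fin 3) ℂ) * h i)) A3 := by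
    rw [hg, hφc, applyLocal_smul, applyLocal_applyLocal, smul_applyLocal 0]
  have hA := isUnit_det_ite_smul (A := fun i => (g i : Matrix (Fin 3) (Fin 3) ℂ) * h i)
    (fun i => by rw [Matrix.det_mul]; exact (isUnit_det_GL (g i)).mul (hu i)) hc 0
  rw [hψ] at hP hLU
  refine hLU (((gramEquiv_of_transforms hu ?_ hU r P _ (applyLocal_A3_ne_zero hA) hP).luEquiv
    hu).trans_proportional hU)
  intro p T hT hj
  have hUT : ∀ j, GramProp (h j * T) (diagOps d j * T) := fun j => by
    rw [hh, Matrix.mul_assoc]; exact gramProp_unitary_mul (U j) _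
  have hU1 : ∀ j, GramProp (h j) (diagOps d j) := fun j => gramProp_unitary_mul (U j) _
  exact (hUT p).trans ((hb.gramProp hd hT fun j hjp =>
    (hUT j).symm.trans ((hj j hjp).trans (hU1 j))).trans (hU1 p).symm)

/-! ### Composing protocols -/

theorem Round.branch_smul {n d : ℕ} (R : Round n d) (k : Fin R.outcomes) (c : ℂ)
    (ψ : QState n d) : R.branch k (c • ψ) = c • R.branch k ψ :=
  applyLocal_smul _ c ψ

theorem Protocol.Transforms.of_proportional {n d : ℕ} {r : ℕ} :
    ∀ {P : Protocol n d} {ψ ψ' φ : QState n d}, P.Transforms r ψ φ → Proportional ψ' ψ →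
      P.Transforms r ψ' φ := by
  induction r with
  | zero => exact fun h h' => Proportional.trans h' h
  | succ r ih =>
    rintro P ψ ψ' φ h ⟨c, hc, rfl⟩ k hk
    rw [Round.branch_smul] at hk ⊢
    exact ih (h k (smul_ne_zero_iff.1 hk).2) ⟨c, hc, rfl⟩

theorem LOCCInRounds.of_one {n d r : ℕ} {ψ χ φ : QState n d} (h : LOCCInRounds 1 ψ χ)
    (h' : LOCCInRounds r χ φ) : LOCCInRounds (r + 1) ψ φ := by
  obtain ⟨P, hP⟩ := h
  obtain ⟨Q, hQ⟩ := h'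
  exact ⟨fun l => match l with
    | [] => P []
    | _ :: t => Q t, fun k hk => Protocol.Transforms.of_proportional hQ (hP k hk)⟩

/-- The round in which nothing happens. -/
def trivialRound {n d : ℕ} (p : Fin n) : Round n d where
  party := p
  outcomes := 1
  kraus := fun _ => 1
  complete := by simp
  unitaries := fun _ _ => 1

theorem trivialRound_branch {n d : ℕ} (p : Fin n) (k) (ψ : QState n d) :
    (trivialRound p).branch k ψ = ψ := by
  unfold Round.branch
  convert applyLocal_one ψ using 2
  exact Function.update_eq_self_iff.2 rfl

theorem LOCCInRounds.succ {n d r : ℕ} (p : Fin n) {ψ φ : QState n d} (h : LOCCInRounds r ψ φ) :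
    LOCCInRounds (r + 1) ψ φ :=
  LOCCInRounds.of_one ⟨fun _ => trivialRound p, fun k _ => by
    change Proportional ((trivialRound p).branch k ψ) ψ
    rw [trivialRound_branch]
    exact Proportional.refl ψ⟩ h

/-- The round in which local unitaries `U` are applied before the round `R` is performed. -/
def Round.precomp {n d : ℕ} (R : Round n d) (U : Fin n → Matrix.unitaryGroup (Fin d) ℂ) :
    Round n d where
  party := R.party
  outcomes := R.outcomes
  kraus := fun k => R.kraus k * U R.party
  complete := by
    have hU : ((U R.party : Matrix (Fin d) (Fin d) ℂ))ᴴ * U R.party = 1 :=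
      Matrix.UnitaryGroup.star_mul_self _
    simp only [gram_mul]
    rw [← Finset.sum_mul, ← Finset.mul_sum, R.complete, Matrix.mul_one, hU]
  unitaries := fun k j => R.unitaries k j * U j

theorem Round.precomp_branch {n d : ℕ} (R : Round n d) (U : Fin n → Matrix.unitaryGroup (Fin d) ℂ)
    (k : Fin R.outcomes) (ψ : QState n d) :
    (R.precomp U).branch k ψ =
      R.branch k (applyLocal (fun i => (U i : Matrix (Fin d) (Fin d) ℂ)) ψ) := by
  unfold Round.branch
  rw [applyLocal_applyLocal]
  congr 1
  funext j
  by_cases hj : j = R.party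
  · subst hj
    simp [Round.precomp]
  · have hj' : j ≠ (R.precomp U).party := hj
    rw [Function.update_of_ne hj', Function.update_of_ne hj]
    rfl

/-- Local unitaries applied beforehand are absorbed in the first round. -/
theorem LUEquiv.loccInRounds {n d r : ℕ} {ψ ψ' φ : QState n d} (h : LUEquiv ψ' ψ)
    (h' : LOCCInRounds (r + 1) ψ φ) : LOCCInRounds (r + 1) ψ' φ := by
  obtain ⟨U, hU⟩ := h
  obtain ⟨P, hP⟩ := h'
  refine ⟨fun l => match l with
    | [] => (P []).precomp U
    | k :: t => P (k :: t), fun k hk => ?_⟩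
  have e : ((P []).precomp U).branch k ψ' = _ := (P []).precomp_branch U k ψ'
  have hk' : ((P []).precomp U).branch k ψ' ≠ 0 := hk
  rw [e] at hk'
  exact e ▸ (Protocol.Transforms.of_proportional (r := r + 1) hP hU.symm) k hk'

/-! ### Reaching a state in one round -/

/-- A state is reached in one round from any state whose Gram matrix at the measuring party `p` is
a positive combination of those obtained by changes of basis `S k` preserving the Gram matrices of
the other parties. The Kraus operators are `√(w k) g_p S_k h_p⁻¹`. -/
theorem loccInRounds_one_of_gram {g h : Fin 3 → Matrix (Fin 3) (Fin 3) ℂ}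
    (hh : ∀ i, IsUnit (h i).det) (p : Fin 3) {m : ℕ} {S : Fin m → Matrix (Fin 3) (Fin 3) ℂ}
    (hS : ∀ k, IsUnit (S k).det) {w : Fin m → ℝ} (hw : ∀ k, 0 < w k)
    (hj : ∀ k, ∀ j ≠ p, (g j * S k)ᴴ * (g j * S k) = (h j)ᴴ * h j)
    (hp : ∑ k, (w k : ℂ) • ((g p * S k)ᴴ * (g p * S k)) = (h p)ᴴ * h p) :
    LOCCInRounds 1 (applyLocal h A3) (applyLocal g A3) := by
  have hU : ∀ k j, ∃ U : Matrix.unitaryGroup (Fin 3) ℂ, j ≠ p →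
      (U : Matrix (Fin 3) (Fin 3) ℂ) * h j = g j * S k := by
    intro k j
    by_cases hjp : j = p
    · exact ⟨1, fun H => absurd hjp H⟩
    · obtain ⟨U, hU⟩ := exists_unitary_mul_eq (hj k j hjp) (hh j)
      exact ⟨U, fun _ => hU⟩
  choose U hU using hU
  refine ⟨fun _ =>
    { party := p
      outcomes := m
      kraus := fun k => ((√(w k) : ℝ) : ℂ) • (g p * S k * (h p)⁻¹)
      complete := ?_
      unitaries := U }, fun k _ => ?_⟩
  · have : ∀ k, (((√(w k) : ℝ) : ℂ) • (g p * S k * (h p)⁻¹))ᴴ *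
        (((√(w k) : ℝ) : ℂ) • (g p * S k * (h p)⁻¹)) =
        ((h p)⁻¹)ᴴ * ((w k : ℂ) • ((g p * S k)ᴴ * (g p * S k))) * (h p)⁻¹ := by
      intro k
      rw [gram_smul, gram_mul _ (h p)⁻¹, Complex.norm_real, Real.norm_eq_abs, sq_abs,
        Real.sq_sqrt (hw k).le, Matrix.mul_smul, Matrix.smul_mul]
    rw [Finset.sum_congr rfl fun k _ => this k, ← Finset.sum_mul, ← Finset.mul_sum, hp,
      ← gram_mul, Matrix.mul_nonsing_inv _ (hh p)]
    simp
  · refine ⟨((√(w k) : ℝ) : ℂ) * (S k).det, mul_ne_zero ?_ (hS k).ne_zero, ?_⟩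
    · exact_mod_cast (Real.sqrt_pos.2 (hw k)).ne'
    · rw [Round.branch, applyLocal_applyLocal, mul_smul, A3,
        ← applyLocal_mul_right_antisymmState, smul_applyLocal p]
      congr 1
      funext j
      by_cases hjp : j = p
      · subst hjp
        simp [Matrix.mul_assoc, Matrix.nonsing_inv_mul _ (hh j)]
      · simp [hjp, hU k j hjp]

theorem gram_apply_self {d : ℕ} (N : Matrix (Fin d) (Fin d) ℂ) (a : Fin d) :
    (Nᴴ * N) a a = ((∑ i, ‖N i a‖ ^ 2 : ℝ) : ℂ) := by
  simp only [Matrix.mul_apply, Matrix.conjTranspose_apply, Complex.star_def, Complex.conj_mul']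
  push_cast
  rfl

theorem sum_norm_sq_col_pos {d : ℕ} {N : Matrix (Fin d) (Fin d) ℂ} (hN : IsUnit N.det)
    (a : Fin d) : 0 < ∑ i, ‖N i a‖ ^ 2 := by
  refine lt_of_le_of_ne (Finset.sum_nonneg fun _ _ => by positivity) fun h => hN.ne_zero ?_
  refine Matrix.det_eq_zero_of_column_eq_zero a fun i => ?_
  have := (Finset.sum_eq_zero_iff_of_nonneg (fun i _ => by positivity)).1 h.symm i
    (Finset.mem_univ i)
  simpa using this

/-- Two Gram matrices can be diagonalized simultaneously, one of them to the identity. -/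
theorem exists_simultaneous_diagonal {A B : Matrix (Fin 3) (Fin 3) ℂ} (hA : IsUnit A.det)
    (hB : IsUnit B.det) : ∃ S : Matrix (Fin 3) (Fin 3) ℂ, IsUnit S.det ∧
      (B * S)ᴴ * (B * S) = 1 ∧ ∃ l : Fin 3 → ℝ, (∀ a, 0 < l a) ∧
        (A * S)ᴴ * (A * S) = Matrix.diagonal fun a => (l a : ℂ) := by
  have hM := Matrix.isHermitian_conjTranspose_mul_self (A * B⁻¹)
  have hspec := hM.conjStarAlgAut_star_eigenvectorUnitary
  set V := hM.eigenvectorUnitary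
  have hV : (V : Matrix (Fin 3) (Fin 3) ℂ)ᴴ * V = 1 := Matrix.UnitaryGroup.star_mul_self V
  have hS : IsUnit (B⁻¹ * (V : Matrix (Fin 3) (Fin 3) ℂ)).det := by
    rw [Matrix.det_mul]
    exact (Matrix.isUnit_nonsing_inv_det _ hB).mul (Matrix.UnitaryGroup.det_isUnit V)
  have hgram : (A * (B⁻¹ * (V : Matrix (Fin 3) (Fin 3) ℂ)))ᴴ * (A * (B⁻¹ * V)) =
      Matrix.diagonal fun a => (hM.eigenvalues a : ℂ) := by
    rw [← Matrix.mul_assoc A, gram_mul]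
    rw [Unitary.conjStarAlgAut_star_apply] at hspec
    exact hspec
  refine ⟨_, hS, ?_, hM.eigenvalues, fun a => ?_, hgram⟩
  · rw [← Matrix.mul_assoc B, Matrix.mul_nonsing_inv _ hB, Matrix.one_mul, hV]
  · have h1 := gram_apply_self (A * (B⁻¹ * (V : Matrix (Fin 3) (Fin 3) ℂ))) a
    rw [hgram, Matrix.diagonal_apply_eq, Complex.ofReal_inj] at h1
    rw [h1]
    exact sum_norm_sq_col_pos (by rw [Matrix.det_mul]; exact hA.mul hS) a

/-- Every state of the class is reached in one round from a diagonal one: in a basis in which the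
Gram matrices of two parties are diagonal, the random sign flips of the basis vectors fix these and
remove the off-diagonal entries of the third. -/
theorem exists_diagOps_loccInRounds_one {g : Fin 3 → Matrix (Fin 3) (Fin 3) ℂ}
    (hg : ∀ i, IsUnit (g i).det) : ∃ d : Fin 3 → Fin 3 → ℝ, (∀ i a, 0 < d i a) ∧
      LOCCInRounds 1 (applyLocal (diagOps d) A3) (applyLocal g A3) := by
  obtain ⟨S, hS, h2, l, hl, h1⟩ := exists_simultaneous_diagonal (hg 1) (hg 2)
  have hgS : IsUnit (g 0 * S).det := by rw [Matrix.det_mul]; exact (hg 0).mul hS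
  set d : Fin 3 → Fin 3 → ℝ := ![fun a => ∑ i, ‖(g 0 * S) i a‖ ^ 2, l, fun _ => 1] with hd
  have hpos : ∀ i a, 0 < d i a := by
    intro i a
    fin_cases i
    · exact sum_norm_sq_col_pos hgS a
    · exact hl a
    · exact one_pos
  -- four of the sign patterns suffice: no flip, or the flip of a single basis vector
  set z : Fin 4 → Fin 3 → ℂ := fun k a => if k = a.castSucc then -1 else 1 with hz
  have hz2 : ∀ k a, star (z k a) * z k a = 1 := by
    intro k a
    simp only [hz]
    split_ifs <;> simp
  have hz0 : ∀ k a, z k a ≠ 0 := fun k a h => by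
    have := hz2 k a
    rw [h, mul_zero] at this
    exact zero_ne_one this
  have flip : ∀ (k) (x : Fin 3 → ℂ), (Matrix.diagonal (z k))ᴴ * Matrix.diagonal x *
      Matrix.diagonal (z k) = Matrix.diagonal x := by
    intro k x
    rw [Matrix.diagonal_conjTranspose, Matrix.diagonal_mul_diagonal, Matrix.diagonal_mul_diagonal]
    congr 1
    funext a
    simp only [Pi.star_apply]
    linear_combination x a * hz2 k a
  refine ⟨d, hpos, loccInRounds_one_of_gram (isUnit_det_diagOps hpos) 0
    (S := fun k : Fin 4 => S * Matrix.diagonal (z k)) (fun k => ?_) (w := fun _ => 1 / 4)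
    (fun _ => by norm_num) ?_ ?_⟩
  · rw [Matrix.det_mul, Matrix.det_diagonal]
    exact hS.mul (isUnit_iff_ne_zero.2 (Finset.prod_ne_zero_iff.2 fun a _ => hz0 k a))
  · intro k j hj
    rw [gram_diagOps hpos, ← Matrix.mul_assoc (g j), gram_mul]
    obtain rfl | rfl : j = 1 ∨ j = 2 := by
      revert j; decide
    · rw [h1, flip]
      rfl
    · rw [h2, ← Matrix.diagonal_one, flip]
      simp [hd]
  · rw [gram_diagOps hpos]
    have entry : ∀ k a b, ((g 0 * (S * Matrix.diagonal (z k)))ᴴ *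
        (g 0 * (S * Matrix.diagonal (z k)))) a b =
        star (z k a) * z k b * ((g 0 * S)ᴴ * (g 0 * S)) a b := by
      intro k a b
      rw [← Matrix.mul_assoc (g 0), gram_mul, Matrix.diagonal_conjTranspose, Matrix.mul_diagonal,
        Matrix.diagonal_mul, Pi.star_apply]
      ring
    have hsum : ∀ a b, ∑ k, ((1 / 4 : ℝ) : ℂ) * star (z k a) * z k b =
        if a = b then 1 else 0 := by
      simp [hz, Fin.sum_univ_four, Fin.forall_fin_succ]
      norm_num
    ext a b
    rw [Matrix.sum_apply]
    simp only [Matrix.smul_apply, smul_eq_mul, entry, ← mul_assoc (((1 / 4 : ℝ) : ℂ))]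
    rw [← Finset.sum_mul, hsum, Matrix.diagonal_apply]
    split_ifs with hab
    · subst hab
      rw [one_mul, gram_apply_self]
      rfl
    · rw [zero_mul]

/-! ### Averaging diagonal states -/

/-- Averaging the diagonal of one party over permutations that fix the diagonals of the others
gives a diagonal state from which the original one is reached in one round. -/
theorem loccInRounds_one_average {d e : Fin 3 → Fin 3 → ℝ} (hd : ∀ i a, 0 < d i a)
    (he : ∀ i a, 0 < e i a) (p : Fin 3) {m : ℕ} (σ : Fin m → Equiv.Perm (Fin 3))
    (hm : 0 < m) (hσ : ∀ k, ∀ j ≠ p, ∀ a, d j (σ k a) = e j a)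
    (hp : ∀ a, e p a = ∑ k, (m : ℝ)⁻¹ * d p (σ k a)) :
    LOCCInRounds 1 (applyLocal (diagOps e) A3) (applyLocal (diagOps d) A3) := by
  have gram : ∀ k j, (diagOps d j * (1 : Matrix (Fin 3) (Fin 3) ℂ).submatrix id (σ k))ᴴ *
      (diagOps d j * (1 : Matrix (Fin 3) (Fin 3) ℂ).submatrix id (σ k)) =
      Matrix.diagonal fun a => (d j (σ k a) : ℂ) := by
    intro k j
    rw [gram_mul, gram_diagOps hd]
    ext a b
    simp only [Matrix.mul_apply, Matrix.diagonal_apply, Matrix.submatrix_apply,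
      Matrix.conjTranspose_apply, Matrix.one_apply, id]
    by_cases hab : a = b
    · subst hab
      simp
    · simp [hab, Ne.symm hab]
  refine loccInRounds_one_of_gram (isUnit_det_diagOps he) p
    (S := fun k => (1 : Matrix (Fin 3) (Fin 3) ℂ).submatrix id (σ k)) (fun k => ?_)
    (w := fun _ => (m : ℝ)⁻¹) (fun _ => by positivity) ?_ ?_
  · rw [Matrix.det_permute', Matrix.det_one, mul_one, isUnit_iff_ne_zero]
    exact_mod_cast (Equiv.Perm.sign _).ne_zero
  · intro k j hj
    rw [gram, gram_diagOps he]
    simp only [hσ k j hj]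
  · simp only [gram]
    rw [gram_diagOps he]
    ext a b
    rw [Matrix.sum_apply]
    simp only [Matrix.smul_apply, Matrix.diagonal_apply, smul_eq_mul]
    split_ifs with hab
    · rw [hp]
      push_cast
      rfl
    · simp

/-- The diagonals relative to that of party `i`. -/
def relativeTo (d : Fin 3 → Fin 3 → ℝ) (i k a : Fin 3) : ℝ := d k a / d i a

theorem relativeTo_pos {d : Fin 3 → Fin 3 → ℝ} (hd : ∀ i a, 0 < d i a) (i k a : Fin 3) :
    0 < relativeTo d i k a := div_pos (hd k a) (hd i a)

theorem relativeTo_self {d : Fin 3 → Fin 3 → ℝ} (hd : ∀ i a, 0 < d i a) (i a : Fin 3) :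
    relativeTo d i i a = 1 := div_self (hd i a).ne'

theorem relativeTo_eq_iff {d : Fin 3 → Fin 3 → ℝ} (hd : ∀ i a, 0 < d i a) {i k a b : Fin 3} :
    relativeTo d i k a = relativeTo d i k b ↔ d i a * d k b = d i b * d k a := by
  rw [relativeTo, relativeTo, div_eq_div_iff (hd i a).ne' (hd i b).ne']
  constructor <;> intro h <;> linarith

theorem luEquiv_relativeTo {d : Fin 3 → Fin 3 → ℝ} (hd : ∀ i a, 0 < d i a) (i : Fin 3) :
    LUEquiv (applyLocal (diagOps (relativeTo d i)) A3) (applyLocal (diagOps d) A3) :=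
  (gramEquiv_diagOps hd (c := fun _ => 1) (s := fun a => (d i a)⁻¹) (fun _ => one_pos)
    (fun a => inv_pos.2 (hd i a)) 1 fun k a => by
      rw [relativeTo, one_mul, div_eq_inv_mul]; rfl).luEquiv (isUnit_det_diagOps hd)

theorem eq_or_eq_of_ne {i j p k : Fin 3} (hip : i ≠ p) (hij : i ≠ j) (hjp : j ≠ p) (hk : k ≠ p) :
    k = i ∨ k = j := by
  revert i j p k; decide

/-- If the ratio of two parties takes equal values at the indices `a` and `b`, averaging the third
over the swap of `a` and `b` makes the columns `a` and `b` equal. -/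
theorem exists_average_swap {d : Fin 3 → Fin 3 → ℝ} (hd : ∀ i a, 0 < d i a) {φ : QState 3 3}
    {r : ℕ} (hφ : LOCCInRounds (r + 1) (applyLocal (diagOps d) A3) φ) {a b i j p : Fin 3}
    (hip : i ≠ p) (hij : i ≠ j) (hjp : j ≠ p) (hab : d i a * d j b = d i b * d j a) :
    ∃ e : Fin 3 → Fin 3 → ℝ, (∀ i a, 0 < e i a) ∧ (∀ k, e k a = e k b) ∧
      LOCCInRounds (r + 2) (applyLocal (diagOps e) A3) φ := by
  set f := relativeTo d i with hf
  have fpos := relativeTo_pos hd i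
  set e : Fin 3 → Fin 3 → ℝ := fun k x => (2 : ℝ)⁻¹ * (f k x + f k (Equiv.swap a b x)) with he
  have epos : ∀ k x, 0 < e k x := fun k x =>
    mul_pos (by norm_num) (add_pos (fpos k x) (fpos k _))
  have inv : ∀ k ≠ p, ∀ x, f k (Equiv.swap a b x) = f k x := by
    intro k hk x
    have hkab : f k a = f k b := by
      obtain rfl | rfl : k = i ∨ k = j := eq_or_eq_of_ne hip hij hjp hk
      · rw [hf, relativeTo_self hd, relativeTo_self hd]
      · exact (relativeTo_eq_iff hd).2 hab
    by_cases hxa : x = a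
    · rw [hxa, Equiv.swap_apply_left, hkab]
    by_cases hxb : x = b
    · rw [hxb, Equiv.swap_apply_right, hkab]
    · rw [Equiv.swap_apply_of_ne_of_ne hxa hxb]
  refine ⟨e, epos, fun k => ?_, ?_⟩
  · simp only [he, Equiv.swap_apply_left, Equiv.swap_apply_right]
    ring
  · refine (loccInRounds_one_average fpos epos p ![1, Equiv.swap a b] (by norm_num) ?_ ?_).of_one
      ((luEquiv_relativeTo hd i).loccInRounds hφ)
    · intro k l hl x
      have : e l x = f l x := by
        simp only [he, inv l hl]
        ring
      rw [this]
      fin_cases k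
      · rfl
      · exact inv l hl x
    · intro x
      simp [he, Fin.sum_univ_two]
      ring

/-- If the ratio of two parties is constant, averaging the third over all cyclic permutations makes
all columns equal. -/
theorem exists_average_cyclic {d : Fin 3 → Fin 3 → ℝ} (hd : ∀ i a, 0 < d i a) {φ : QState 3 3}
    {r : ℕ} (hφ : LOCCInRounds (r + 1) (applyLocal (diagOps d) A3) φ) {i j p : Fin 3}
    (hip : i ≠ p) (hij : i ≠ j) (hjp : j ≠ p)
    (hab : ∀ x y, relativeTo d i j x = relativeTo d i j y) :
    ∃ e : Fin 3 → Fin 3 → ℝ, (∀ i a, 0 < e i a) ∧ (∀ k x y, e k x = e k y) ∧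
      LOCCInRounds (r + 2) (applyLocal (diagOps e) A3) φ := by
  set f := relativeTo d i with hf
  have fpos := relativeTo_pos hd i
  set e : Fin 3 → Fin 3 → ℝ := fun k _ => ∑ y, (3 : ℝ)⁻¹ * f k y with he
  have epos : ∀ k x, 0 < e k x := fun k x =>
    Finset.sum_pos (fun y _ => mul_pos (by norm_num) (fpos k y)) Finset.univ_nonempty
  refine ⟨e, epos, fun k x y => rfl, ?_⟩
  refine (loccInRounds_one_average fpos epos p (fun k : Fin 3 => Equiv.addRight k) (by norm_num)
    ?_ ?_).of_one ((luEquiv_relativeTo hd i).loccInRounds hφ)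
  · intro k l hl x
    have hconst : ∀ x y, f l x = f l y := by
      obtain rfl | rfl : l = i ∨ l = j := eq_or_eq_of_ne hip hij hjp hl
      · intro x y
        rw [hf, relativeTo_self hd, relativeTo_self hd]
      · exact hab
    have : e l x = f l x := by
      simp only [he]
      rw [Finset.sum_congr rfl fun y _ => by rw [hconst y x]]
      simp
    rw [this]
    exact hconst _ _
  · intro x
    simp only [he]
    exact (Equiv.sum_comp (Equiv.addLeft x) fun y => (3 : ℝ)⁻¹ * f p y).symm

theorem exists_of_not_isBalanced {d : Fin 3 → Fin 3 → ℝ} (h : ¬ IsBalanced d) :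
    ∃ a b i j p, i ≠ p ∧ i ≠ j ∧ j ≠ p ∧
      d i a * d j b = d i b * d j a ∧ d i a * d p b ≠ d i b * d p a := by
  unfold IsBalanced at h
  push Not at h
  obtain ⟨a, b, i, j, hij, hab, p, hp⟩ := h
  refine ⟨a, b, i, j, p, ?_, hij, ?_, hab, hp⟩
  · rintro rfl
    exact hp (mul_comm _ _)
  · rintro rfl
    exact hp hab

/-- After a first average two columns are equal. If the result is still unbalanced, then the ratio
of some two parties is constant, so that a second average makes all columns equal. -/
theorem exists_balanced_loccInRounds {d : Fin 3 → Fin 3 → ℝ} (hd : ∀ i a, 0 < d i a)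
    {φ : QState 3 3} {r : ℕ} (hφ : LOCCInRounds (r + 1) (applyLocal (diagOps d) A3) φ) :
    ∃ e : Fin 3 → Fin 3 → ℝ, (∀ i a, 0 < e i a) ∧ IsBalanced e ∧
      LOCCInRounds (r + 3) (applyLocal (diagOps e) A3) φ := by
  by_cases hb : IsBalanced d
  · exact ⟨d, hd, hb, (hφ.succ 0).succ 0⟩
  obtain ⟨a, b, i, j, p, hip, hij, hjp, h1, h2⟩ := exists_of_not_isBalanced hb
  have hab : a ≠ b := by
    rintro rfl
    exact h2 rfl
  obtain ⟨e, he, heab, hφe⟩ := exists_average_swap hd hφ hip hij hjp h1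
  by_cases hb' : IsBalanced e
  · exact ⟨e, he, hb', hφe.succ 0⟩
  obtain ⟨a', b', i', j', p', hip', hij', hjp', h1', h2'⟩ := exists_of_not_isBalanced hb'
  have hab' : a' ≠ b' := by
    rintro rfl
    exact h2' rfl
  have cover : ∀ a b a' b' x : Fin 3, a ≠ b → a' ≠ b' → ¬ (a' = a ∧ b' = b) →
      ¬ (a' = b ∧ b' = a) → x = a ∨ x = b ∨ (x = a' ∧ (b' = a ∨ b' = b)) ∨
        (x = b' ∧ (a' = a ∨ a' = b)) := by
    decide
  have hconst : ∀ x, relativeTo e i' j' x = relativeTo e i' j' a := by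
    have hfb : relativeTo e i' j' b = relativeTo e i' j' a := by
      rw [relativeTo, relativeTo, heab, heab]
    have hf' := (relativeTo_eq_iff he).2 h1'
    intro x
    rcases cover a b a' b' x hab hab' (by rintro ⟨rfl, rfl⟩; exact h2' (by rw [heab i', heab p']))
      (by rintro ⟨rfl, rfl⟩; exact h2' (by rw [heab i', heab p'])) with
      rfl | rfl | ⟨rfl, rfl | rfl⟩ | ⟨rfl, rfl | rfl⟩
    · rfl
    · exact hfb
    · exact hf'
    · exact hf'.trans hfb
    · exact hf'.symm
    · exact hf'.symm.trans hfb
  obtain ⟨f, hf, hfc, hφf⟩ := exists_average_cyclic he hφe hip' hij' hjp'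
    fun x y => (hconst x).trans (hconst y).symm
  refine ⟨f, hf, fun x y k l _ _ q => ?_, hφf⟩
  rw [hfc k x y, hfc q x y]

theorem exists_type_loccInRounds_three {φ : QState 3 3} (hφ : φ ∈ SLOCCClass A3) :
    ∃ ψ, (IsTypeI ψ ∨ IsTypeII ψ ∨ IsTypeIII ψ) ∧ LOCCInRounds 3 ψ φ := by
  obtain ⟨g, rfl⟩ := hφ
  obtain ⟨d, hd, h1⟩ := exists_diagOps_loccInRounds_one fun i => isUnit_det_GL (g i)
  obtain ⟨e, he, hb, h3⟩ := exists_balanced_loccInRounds (r := 0) hd h1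
  obtain ⟨ψ, hψ, hLU⟩ := hb.exists_type he
  exact ⟨ψ, hψ, hLU.loccInRounds h3⟩

/-! ### Finite protocols as infinite ones -/

theorem Protocol.fidelity_zero {n d : ℕ} (r : ℕ) :
    ∀ (P : Protocol n d) (φ : QState n d), P.fidelity r 0 φ = 0 := by
  induction r with
  | zero => intro P φ; simp [Protocol.fidelity]
  | succ r ih =>
    intro P φ
    refine Finset.sum_eq_zero fun k _ => ?_
    rw [show (P []).branch k (0 : QState n d) = 0 from applyLocal_zero _, ih]

theorem Protocol.fidelity_trivialRound {n d : ℕ} (p : Fin n) (r : ℕ) (ψ φ : QState n d) :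
    Protocol.fidelity r (fun _ => trivialRound p) ψ φ = ‖inner ℂ φ ψ‖ ^ 2 := by
  induction r with
  | zero => rfl
  | succ r ih =>
    change ∑ k : Fin 1, Protocol.fidelity r (fun _ => trivialRound p)
      ((trivialRound p).branch k ψ) φ = _
    rw [Fin.sum_univ_one]
    exact (congrArg (fun χ => Protocol.fidelity r _ χ φ)
      (trivialRound_branch p (0 : Fin 1) ψ)).trans ih

/-- The protocol that follows `P` for `r` rounds and does nothing afterwards. -/
def Protocol.stopAfter {n d : ℕ} (p : Fin n) : ℕ → Protocol n d → Protocol n d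
  | 0, _ => fun _ => trivialRound p
  | r + 1, P => fun l => match l with
    | [] => P []
    | k :: t => Protocol.stopAfter p r (P.after k) t

theorem Protocol.Transforms.fidelity_stopAfter {n d : ℕ} (p : Fin n) (s : ℕ) {φ : QState n d}
    {r : ℕ} : ∀ {P : Protocol n d} {ψ : QState n d}, P.Transforms r ψ φ →
      (Protocol.stopAfter p r P).fidelity (r + s) ψ φ = ‖ψ‖ ^ 2 * ‖φ‖ ^ 2 := by
  induction r with
  | zero =>
    rintro P ψ ⟨c, -, rfl⟩
    rw [Protocol.stopAfter, Protocol.fidelity_trivialRound, inner_smul_right, norm_smul, norm_mul,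
      inner_self_eq_norm_sq_to_K]
    simp
    ring
  | succ r ih =>
    intro P ψ h
    rw [Nat.succ_add]
    change ∑ k : Fin (P []).outcomes, Protocol.fidelity (r + s)
      (Protocol.stopAfter p r (P.after k)) ((P []).branch k ψ) φ = _
    rw [← (P []).sum_norm_sq_branch ψ, Finset.sum_mul]
    refine Finset.sum_congr rfl fun k _ => ?_
    by_cases hk : (P []).branch k ψ = 0
    · rw [hk, Protocol.fidelity_zero]
      simp
    · exact ih (h k hk)

theorem LOCCInRounds.loccConvertible {n d r : ℕ} (p : Fin n) {ψ φ : QState n d}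
    (h : LOCCInRounds r ψ φ) : LOCCConvertible ψ φ := by
  obtain ⟨P, hP⟩ := h
  refine ⟨Protocol.stopAfter p r P, ?_⟩
  refine tendsto_const_nhds.congr' ?_
  filter_upwards [Filter.eventually_ge_atTop r] with m hm
  obtain ⟨s, rfl⟩ := Nat.exists_eq_add_of_le hm
  exact (hP.fidelity_stopAfter p s).symm

theorem mem_SLOCCClass_of_mem {n d : ℕ} {ψ φ χ : QState n d} (hψ : ψ ∈ SLOCCClass χ)
    (hφ : φ ∈ SLOCCClass χ) : ψ ∈ SLOCCClass φ := by
  obtain ⟨g, rfl⟩ := hψ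
  obtain ⟨h, rfl⟩ := hφ
  refine ⟨fun i => g i * (h i)⁻¹, ?_⟩
  rw [applyLocal_applyLocal]
  congr 1
  funext i
  rw [← Units.val_mul, inv_mul_cancel_right]

theorem maximallyEntangledSet_subset_MA3 : maximallyEntangledSet A3 ⊆ MA3 := by
  rintro φ ⟨hφ, hreach⟩
  obtain ⟨ψ, hψ, h3⟩ := exists_type_loccInRounds_three hφ
  by_contra hM
  have hLU : ¬ LUEquiv ψ φ := fun h => hM ⟨ψ, hψ, h⟩
  have hψM : ψ ∈ MA3 := ⟨ψ, hψ, fun _ => 1, by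
    change Proportional ψ (applyLocal (fun _ => 1) ψ)
    rw [applyLocal_one]
    exact Proportional.refl ψ⟩
  exact hreach ⟨ψ, mem_SLOCCClass_of_mem (MA3_subset_SLOCCClass hψM) hφ, hLU,
    h3.loccConvertible 0⟩

/-! ### Null sets -/

open MeasureTheory in
/-- A measurable set that meets every line through `x₀` in a countable set is a null set: by
Fubini almost every dilate of it about `x₀` is null, and dilation rescales Haar measure. -/
theorem measure_zero_of_countable_lines {E : Type*} [NormedAddCommGroup E] [NormedSpace ℝ E]
    [MeasurableSpace E] [BorelSpace E] [FiniteDimensional ℝ E] (μ : Measure E)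
    [μ.IsAddHaarMeasure] {Z : Set E} (hZ : MeasurableSet Z) (x₀ : E)
    (h : ∀ x : E, {t : ℝ | x₀ + t • x ∈ Z}.Countable) : μ Z = 0 := by
  set W : Set E := (fun x => x₀ + x) ⁻¹' Z with hW
  have hWm : MeasurableSet W := (measurable_const_add x₀) hZ
  have hT : MeasurableSet {q : E × ℝ | q.2 • q.1 ∈ W} :=
    (continuous_snd.smul continuous_fst).measurable hWm
  have h0 : (μ.prod (volume : Measure ℝ)) {q : E × ℝ | q.2 • q.1 ∈ W} = 0 := by
    rw [Measure.measure_prod_null hT]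
    exact Filter.Eventually.of_forall fun x => (h x).measure_zero volume
  have h1 : ∀ᵐ t : ℝ, μ {x : E | t • x ∈ W} = 0 := by
    have hT' : MeasurableSet {q : ℝ × E | q.1 • q.2 ∈ W} :=
      (continuous_fst.smul continuous_snd).measurable hWm
    have h0' : ((volume : Measure ℝ).prod μ) {q : ℝ × E | q.1 • q.2 ∈ W} = 0 := by
      rw [← Measure.prod_swap, Measure.map_apply measurable_swap hT']
      exact h0
    exact (Measure.measure_prod_null hT').1 h0'
  have h2 : ∀ᵐ t : ℝ, t ≠ 0 := by
    simp [ae_iff]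
  obtain ⟨t, ht, ht0⟩ := (h1.and h2).exists
  have h3 := Measure.addHaar_preimage_smul μ ht0 W
  rw [show (fun x => t • x) ⁻¹' W = {x : E | t • x ∈ W} from rfl, ht] at h3
  have h4 : μ W = 0 := by
    refine (mul_eq_zero.1 h3.symm).resolve_left ?_
    rw [ENNReal.ofReal_eq_zero, not_le]
    positivity
  rwa [hW, measure_preimage_add] at h4

/-- The commutator of `G 1` and `G 2` relative to `G 0`, with the inverse of `G 0` replaced by its
adjugate in order to be polynomial in the entries. It vanishes if the three matrices are
simultaneously congruent to diagonal ones. -/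
def relCommutator {R : Type*} [CommRing R] (G : Fin 3 → Matrix (Fin 3) (Fin 3) R) :
    Matrix (Fin 3) (Fin 3) R :=
  G 1 * (G 0).adjugate * G 2 - G 2 * (G 0).adjugate * G 1

theorem relCommutator_map {R R' : Type*} [CommRing R] [CommRing R'] (f : R →+* R')
    (G : Fin 3 → Matrix (Fin 3) (Fin 3) R) :
    f.mapMatrix (relCommutator G) = relCommutator fun i => f.mapMatrix (G i) := by
  simp only [relCommutator, map_sub, map_mul, RingHom.map_adjugate]

theorem relCommutator_eq_zero_of_mem_MA3 {g : Fin 3 → Matrix (Fin 3) (Fin 3) ℂ}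
    (h : applyLocal g A3 ∈ MA3) : relCommutator (fun i => (g i)ᴴ * g i) = 0 := by
  obtain ⟨d, hd, -, U, hU⟩ := exists_balanced_of_mem_MA3 h
  obtain ⟨S, -, hS⟩ := gramEquiv_of_proportional (isUnit_det_unitary_mul_diagOps hd U) hU
  have hG : ∀ i, ∃ D : Fin 3 → ℂ, (g i)ᴴ * g i = Sᴴ * Matrix.diagonal D * S := by
    intro i
    obtain ⟨c, -, e⟩ := hS i
    refine ⟨fun a => (c : ℂ) * (d i a : ℂ), ?_⟩
    rw [e, Matrix.mul_assoc, gram_unitary_mul, gram_mul, gram_diagOps hd, ← Matrix.smul_mul,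
      ← Matrix.mul_smul, ← Matrix.diagonal_smul]
    rfl
  choose D hD using hG
  have key : ∀ x y z : Fin 3 → ℂ, (Sᴴ * Matrix.diagonal x * S) *
      (Sᴴ * Matrix.diagonal y * S).adjugate * (Sᴴ * Matrix.diagonal z * S) =
      (S.det * Sᴴ.det) • (Sᴴ * (Matrix.diagonal x * (Matrix.diagonal y).adjugate *
        Matrix.diagonal z) * S) := by
    intro x y z
    rw [Matrix.adjugate_mul_distrib, Matrix.adjugate_mul_distrib]
    calc _ = Sᴴ * Matrix.diagonal x * (S * S.adjugate) * (Matrix.diagonal y).adjugate *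
          (Sᴴ.adjugate * Sᴴ) * Matrix.diagonal z * S := by simp only [Matrix.mul_assoc]
      _ = _ := by
        rw [Matrix.mul_adjugate, Matrix.adjugate_mul]
        simp only [Matrix.mul_assoc, Matrix.smul_mul, Matrix.mul_smul, Matrix.one_mul, smul_smul]
        rw [mul_comm]
  rw [relCommutator, hD 0, hD 1, hD 2, key, key, ← smul_sub, ← Matrix.sub_mul, ← Matrix.mul_sub]
  have : Matrix.diagonal (D 1) * (Matrix.diagonal (D 0)).adjugate * Matrix.diagonal (D 2) =
      Matrix.diagonal (D 2) * (Matrix.diagonal (D 0)).adjugate * Matrix.diagonal (D 1) := by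
    rw [Matrix.adjugate_diagonal]
    simp only [Matrix.diagonal_mul_diagonal]
    congr 1
    funext a
    ring
  rw [this, sub_self]
  simp

/-- Along a real line the relative commutator of the Gram matrices is polynomial in the
parameter. -/
theorem exists_polynomial_relCommutator (x y : Fin 3 → Matrix (Fin 3) (Fin 3) ℂ) (a b : Fin 3) :
    ∃ F : Polynomial ℂ, ∀ t : ℝ, relCommutator (fun i => (x i + (t : ℂ) • y i)ᴴ *
      (x i + (t : ℂ) • y i)) a b = F.eval (t : ℂ) := by
  set lin : Matrix (Fin 3) (Fin 3) ℂ → Matrix (Fin 3) (Fin 3) ℂ →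
      Matrix (Fin 3) (Fin 3) (Polynomial ℂ) := fun u v =>
    Matrix.of fun i j => Polynomial.C (u i j) + Polynomial.X * Polynomial.C (v i j) with hlin
  refine ⟨relCommutator (fun i => lin (x i)ᴴ (y i)ᴴ * lin (x i) (y i)) a b, fun t => ?_⟩
  have hev : ∀ u v, (Polynomial.evalRingHom (t : ℂ)).mapMatrix (lin u v) = u + (t : ℂ) • v := by
    intro u v
    ext i j
    simp [hlin]
    exact mul_comm _ _
  have h := congrFun (congrFun (relCommutator_map (Polynomial.evalRingHom (t : ℂ))
    fun i => lin (x i)ᴴ (y i)ᴴ * lin (x i) (y i)) a) b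
  simp only [map_mul, hev] at h
  have e : ∀ i, (x i + (t : ℂ) • y i)ᴴ = (x i)ᴴ + (t : ℂ) • (y i)ᴴ := fun i => by
    rw [Matrix.conjTranspose_add, Matrix.conjTranspose_smul, Complex.star_def, Complex.conj_ofReal]
  simp only [e]
  exact h.symm

open MeasureTheory in
theorem nullInSLOCCClass_MA3 : NullInSLOCCClass A3 MA3 := by
  set f : (Fin 3 → Fin 3 → Fin 3 → ℂ) → ℂ := fun g =>
    relCommutator (fun i => (Matrix.of (g i))ᴴ * Matrix.of (g i)) 0 1 with hf
  refine MeasureTheory.measure_mono_null (t := {g | f g = 0}) ?_ ?_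
  · rintro g ⟨-, hg⟩
    exact congrFun (congrFun (relCommutator_eq_zero_of_mem_MA3 hg) 0) 1
  -- Gram matrices `𝟙`, `|0⟩⟨0|` and `|u⟩⟨u|` with `u = (1, 1, 0)`: the latter two do not commute
  set x₀ : Fin 3 → Fin 3 → Fin 3 → ℂ :=
    ![(1 : Matrix (Fin 3) (Fin 3) ℂ), !![1, 0, 0; 0, 0, 0; 0, 0, 0], !![1, 1, 0; 0, 0, 0; 0, 0, 0]]
    with hx₀
  have hfx : f x₀ ≠ 0 := by
    have h0 : Matrix.of (x₀ 0) = 1 := rfl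
    have h1 : Matrix.of (x₀ 1) = !![1, 0, 0; 0, 0, 0; 0, 0, 0] := rfl
    have h2 : Matrix.of (x₀ 2) = !![1, 1, 0; 0, 0, 0; 0, 0, 0] := rfl
    simp only [hf, relCommutator, h0, h1, h2]
    simp [Matrix.mul_apply, Fin.sum_univ_three]
  have hcont : Continuous f := by
    have hof : ∀ i, Continuous fun g : Fin 3 → Fin 3 → Fin 3 → ℂ => Matrix.of (g i) :=
      fun i => continuous_apply i
    have hG : ∀ i, Continuous fun g : Fin 3 → Fin 3 → Fin 3 → ℂ =>
        (Matrix.of (g i))ᴴ * Matrix.of (g i) := fun i =>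
      (hof i).matrix_conjTranspose.matrix_mul (hof i)
    exact ((((hG 1).matrix_mul (hG 0).matrix_adjugate).matrix_mul (hG 2)).sub
      (((hG 2).matrix_mul (hG 0).matrix_adjugate).matrix_mul (hG 1))).matrix_elem 0 1
  have haar₁ : (volume : Measure (Fin 3 → ℂ)).IsAddHaarMeasure := Measure.pi.isAddHaarMeasure _
  have haar₂ : (volume : Measure (Fin 3 → Fin 3 → ℂ)).IsAddHaarMeasure :=
    Measure.pi.isAddHaarMeasure _
  have haar₃ : (volume : Measure (Fin 3 → Fin 3 → Fin 3 → ℂ)).IsAddHaarMeasure :=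
    Measure.pi.isAddHaarMeasure _
  refine measure_zero_of_countable_lines _ (isClosed_singleton.preimage hcont).measurableSet x₀
    fun y => ?_
  obtain ⟨F, hF⟩ := exists_polynomial_relCommutator (fun i => Matrix.of (x₀ i))
    (fun i => Matrix.of (y i)) 0 1
  have hline : ∀ t : ℝ, f (x₀ + t • y) = F.eval (t : ℂ) := fun t => by
    rw [← hF]
    rfl
  have hF0 : F ≠ 0 := by
    rintro rfl
    have := hline 0
    rw [zero_smul, add_zero, Polynomial.eval_zero] at this
    exact hfx this
  refine (((F.roots.toFinset.finite_toSet).preimage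
    (Complex.ofReal_injective.injOn)).subset ?_).countable
  intro t ht
  have ht' : f (x₀ + t • y) = 0 := ht
  rw [hline] at ht'
  simp [hF0, ht']

end QuditLOCC
end

theorem mainTheorem4 :
    (∀ φ ∈ QuditLOCC.SLOCCClass QuditLOCC.A3,
      ∃ ψ, (QuditLOCC.IsTypeI ψ ∨ QuditLOCC.IsTypeII ψ ∨ QuditLOCC.IsTypeIII ψ) ∧
        (QuditLOCC.LUEquiv ψ φ ∨ QuditLOCC.LOCCInRounds 3 ψ φ)) ∧
    QuditLOCC.MA3 ⊆ QuditLOCC.SLOCCClass QuditLOCC.A3 ∧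
    (∀ φ ∈ QuditLOCC.MA3, ¬ QuditLOCC.LOCCNReachable φ) ∧
    QuditLOCC.maximallyEntangledSet QuditLOCC.A3 ⊆ QuditLOCC.MA3 ∧
    QuditLOCC.NullInSLOCCClass QuditLOCC.A3 QuditLOCC.MA3 := by
  refine ⟨fun φ hφ => ?_, QuditLOCC.MA3_subset_SLOCCClass,
    fun φ hφ => QuditLOCC.not_LOCCNReachable_of_mem_MA3 hφ,
    QuditLOCC.maximallyEntangledSet_subset_MA3, QuditLOCC.nullInSLOCCClass_MA3⟩
  obtain ⟨ψ, hψ, h⟩ := QuditLOCC.exists_type_loccInRounds_three hφ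
  exact ⟨ψ, hψ, Or.inr h⟩
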